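/- Let $D<0$ be an integer with $D\equiv 0$ or $1 \pmod 4$. Let $C(D)$ be the class group of discriminant $D$: its elements are the classes, under substitutions from $SL_2(\mathbb{Z})$, of primitive positive definite integral binary quadratic forms $ax^2+bxy+cy^2$ with $b^2-4ac=D$, and its operation is (Dirichlet) composition of forms. Let $r$ be an odd positive integer with prime factorization $r=\prod_{i=1}^k p_i^{e_i}$, and put $$\varphi_D(r)=\prod_{i=1}^k p_i^{e_i-1}\left(p_i-\left(\frac{D}{p_i}\right)\right),$$ where $\left(\frac{D}{p}\right)$ is the Kronecker symbol. Let $f\in C(Dr^2)$ be derived from $g\in C(D)$, i.e. for some forms representing these classes, denoted by the same letters, there is an integral $2\times 2$ matrix $A$ with $\det A=r$ and $f(x,y)=g(A\cdot(x,y)^T)$. If $a$ is the order of $g$ in $C(D)$, then the order of $f$ in $C(Dr^2)$ divides $a\cdot\varphi_D(r)$. -/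

import Mathlib

open scoped MatrixGroups

namespace BQF

/-- `D` is a negative discriminant: `D < 0` and `D ≡ 0, 1 (mod 4)`. -/
class NegDisc (D : ℤ) : Prop where
  neg : D < 0
  mod_four : D % 4 = 0 ∨ D % 4 = 1

instance NegDisc.mul_sq (D : ℤ) [h : NegDisc D] (r : ℕ) [NeZero r] :
    NegDisc (D * (r : ℤ) ^ 2) where
  neg := mul_neg_of_neg_of_pos h.neg (by have := NeZero.ne r; positivity)
  mod_four := by
    have h1 := h.mod_four
    have h2 : ((r : ℤ) ^ 2) % 4 = 0 ∨ ((r : ℤ) ^ 2) % 4 = 1 := by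
      rcases Int.even_or_odd' (r : ℤ) with ⟨k, hk | hk⟩ <;> rw [hk]
      · left; ring_nf; omega
      · right; ring_nf; omega
    rw [Int.mul_emod]
    rcases h1 with h1 | h1 <;> rcases h2 with h2 | h2 <;> simp [h1, h2]

/-- A primitive integral binary quadratic form `a x² + b x y + c y²` of discriminant `D`
with `a > 0`. For `D < 0`, the condition `a > 0` says that the form is positive definite. -/
@[ext]
structure Form (D : ℤ) where
  a : ℤ
  b : ℤ
  c : ℤ
  disc : b ^ 2 - 4 * a * c = D
  primitive : Int.gcd (Int.gcd a b) c = 1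
  pos : 0 < a

namespace Form

variable {D : ℤ}

/-- The value `f(x, y)`. -/
def eval (f : Form D) (x y : ℤ) : ℤ := f.a * x ^ 2 + f.b * x * y + f.c * y ^ 2

/-- `f ∼ g`: there is `A ∈ SL₂(ℤ)` with `f(x, y) = g(A (x, y)ᵀ)`. -/
def Equiv (f g : Form D) : Prop :=
  ∃ A : SL(2, ℤ), ∀ x y : ℤ, f.eval x y = g.eval (A 0 0 * x + A 0 1 * y) (A 1 0 * x + A 1 1 * y)

/-- `f`, of discriminant `D'`, equals `g(A (x, y)ᵀ)` for an integral matrix `A` of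
determinant `r`. -/
def IsDerived {D' : ℤ} (r : ℤ) (f : Form D') (g : Form D) : Prop :=
  ∃ A : Matrix (Fin 2) (Fin 2) ℤ, A.det = r ∧
    ∀ x y : ℤ, f.eval x y = g.eval (A 0 0 * x + A 0 1 * y) (A 1 0 * x + A 1 1 * y)

/-- `h` is a Dirichlet composition of `f = (a₁, b₁, c₁)` and `g = (a₂, b₂, c₂)`:
`gcd(a₁, a₂, (b₁ + b₂)/2) = 1` and `h = (a₁ a₂, B, (B² - D) / (4 a₁ a₂))` with
`B ≡ b₁ (mod 2 a₁)` and `B ≡ b₂ (mod 2 a₂)`. The last coefficient of `h`, and the congruence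
`B² ≡ D (mod 4 a₁ a₂)`, come from `h` having discriminant `D`. -/
def IsDirichletComposition (f g h : Form D) : Prop :=
  Int.gcd (Int.gcd f.a g.a) ((f.b + g.b) / 2) = 1 ∧
    h.a = f.a * g.a ∧ h.b ≡ f.b [ZMOD 2 * f.a] ∧ h.b ≡ g.b [ZMOD 2 * g.a]

/-! ### Equivalence in coordinates -/

theorem equiv_iff (f g : Form D) : f.Equiv g ↔ ∃ p q r s : ℤ, p * s - q * r = 1 ∧
    f.a = g.eval p r ∧ f.b = 2 * g.a * p * q + g.b * (p * s + q * r) + 2 * g.c * r * s ∧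
    f.c = g.eval q s := by
  constructor
  · rintro ⟨A, hA⟩
    refine ⟨A 0 0, A 0 1, A 1 0, A 1 1, ?_, ?_, ?_, ?_⟩
    · have := A.det_coe; rwa [Matrix.det_fin_two] at this
    · have := hA 1 0; simp [eval] at this ⊢; linarith
    · have h1 := hA 1 1
      have h2 := hA 1 0
      have h3 := hA 0 1
      simp only [eval] at h1 h2 h3 ⊢
      linear_combination h1 - h2 - h3
    · have := hA 0 1; simp [eval] at this ⊢; linarith
  · rintro ⟨p, q, r, s, h, ha, hb, hc⟩
    refine ⟨⟨!![p, q; r, s], by rw [Matrix.det_fin_two]; simpa using h⟩, fun x y => ?_⟩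
    simp only [eval] at ha hc ⊢
    simp only [Matrix.of_apply, Matrix.cons_val', Matrix.cons_val_zero, Matrix.cons_val_one,
      Matrix.cons_val_fin_one]
    rw [ha, hb, hc]; ring

theorem equiv_refl (f : Form D) : f.Equiv f := ⟨1, fun x y => by simp⟩

theorem equiv_symm {f g : Form D} (h : f.Equiv g) : g.Equiv f := by
  obtain ⟨A, hA⟩ := h
  refine ⟨A⁻¹, fun x y => ?_⟩
  have hd : A 0 0 * A 1 1 - A 0 1 * A 1 0 = 1 := by
    have := A.det_coe; rwa [Matrix.det_fin_two] at this
  rw [hA]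
  simp only [Matrix.SpecialLinearGroup.SL2_inv_expl A, Matrix.cons_val',
    Matrix.cons_val_zero, Matrix.cons_val_one, Matrix.cons_val_fin_one]
  congr 1
  · linear_combination (-x) * hd
  · linear_combination (-y) * hd

theorem equiv_trans {f g h : Form D} (h₁ : f.Equiv g) (h₂ : g.Equiv h) : f.Equiv h := by
  obtain ⟨A, hA⟩ := h₁
  obtain ⟨B, hB⟩ := h₂
  refine ⟨B * A, fun x y => ?_⟩
  rw [hA, hB]
  simp only [Matrix.SpecialLinearGroup.coe_mul, Matrix.mul_apply, Fin.sum_univ_two]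
  congr 1 <;> ring

instance setoid (D : ℤ) : Setoid (Form D) := ⟨Equiv, equiv_refl, equiv_symm, equiv_trans⟩

/-! ### The lattice of a form, used only to verify that composition is well defined -/

section Lattice

/-- A square root of the negative number `D` in the upper half plane. -/
noncomputable def rt (D : ℤ) : ℂ := (Real.sqrt (-D) : ℝ) * Complex.I

theorem rt_sq [h : NegDisc D] : rt D ^ 2 = D := by
  have h0 : (0 : ℝ) ≤ -D := by
    have : (D : ℝ) < 0 := by exact_mod_cast h.neg
    linarith
  rw [rt, mul_pow, Complex.I_sq, ← Complex.ofReal_pow, Real.sq_sqrt h0]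
  push_cast; ring

theorem rt_indep [h : NegDisc D] {x y z w : ℤ} (e : (x : ℂ) + y * rt D = z + w * rt D) :
    x = z ∧ y = w := by
  have h0 : Real.sqrt (-D) ≠ 0 := by
    have : (D : ℝ) < 0 := by exact_mod_cast h.neg
    exact (Real.sqrt_pos.2 (by linarith)).ne'
  have hre := congrArg Complex.re e
  have him := congrArg Complex.im e
  simp [rt] at hre him
  refine ⟨by exact_mod_cast hre, ?_⟩
  rcases him with him | him
  · exact_mod_cast him
  · exact absurd him h0

theorem rt_ne [h : NegDisc D] : rt D ≠ 0 := by
  intro e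
  have := rt_sq (D := D)
  rw [e] at this
  have h2 : (D : ℂ) = 0 := by rw [← this]; simp
  have := h.neg
  have h3 : D = 0 := by exact_mod_cast h2
  omega

/-- The lattice `ℤ 2a + ℤ (-b + √D)` of the form `(a, b, c)`. -/
noncomputable def lat (f : Form D) : Submodule ℤ ℂ :=
  Submodule.span ℤ {(2 * f.a : ℂ), -f.b + rt D}

/-- Two lattices in `ℂ` are homothetic. -/
def Homothetic (L M : Submodule ℤ ℂ) : Prop :=
  ∃ u v : ℂ, u ≠ 0 ∧ v ≠ 0 ∧ Submodule.span ℤ {u} * L = Submodule.span ℤ {v} * M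

theorem Homothetic.of_eq {L M : Submodule ℤ ℂ} (h : L = M) : Homothetic L M :=
  ⟨1, 1, one_ne_zero, one_ne_zero, by rw [h]⟩

theorem Homothetic.symm {L M : Submodule ℤ ℂ} (h : Homothetic L M) : Homothetic M L := by
  obtain ⟨u, v, hu, hv, e⟩ := h
  exact ⟨v, u, hv, hu, e.symm⟩

theorem span_singleton_mul_mul (u v : ℂ) (L M : Submodule ℤ ℂ) :
    Submodule.span ℤ {u * v} * (L * M) =
      (Submodule.span ℤ {u} * L) * (Submodule.span ℤ {v} * M) := by
  have : Submodule.span ℤ {u * v} = Submodule.span ℤ {u} * Submodule.span ℤ {v} := by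
    rw [Submodule.span_mul_span, Set.singleton_mul_singleton]
  rw [this, mul_mul_mul_comm]

theorem span_singleton_mul' (u v : ℂ) (L : Submodule ℤ ℂ) :
    Submodule.span ℤ {u * v} * L = Submodule.span ℤ {u} * (Submodule.span ℤ {v} * L) := by
  have : Submodule.span ℤ {u * v} = Submodule.span ℤ {u} * Submodule.span ℤ {v} := by
    rw [Submodule.span_mul_span, Set.singleton_mul_singleton]
  rw [this, mul_assoc]

theorem Homothetic.trans {L M N : Submodule ℤ ℂ} (h : Homothetic L M) (h' : Homothetic M N) :
    Homothetic L N := by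
  obtain ⟨u, v, hu, hv, e⟩ := h
  obtain ⟨u', v', hu', hv', e'⟩ := h'
  refine ⟨u' * u, v * v', mul_ne_zero hu' hu, mul_ne_zero hv hv', ?_⟩
  rw [span_singleton_mul', e, ← span_singleton_mul', mul_comm u' v, span_singleton_mul', e',
    ← span_singleton_mul']

theorem Homothetic.mul {L M L' M' : Submodule ℤ ℂ} (h : Homothetic L M)
    (h' : Homothetic L' M') : Homothetic (L * L') (M * M') := by
  obtain ⟨u, v, hu, hv, e⟩ := h
  obtain ⟨u', v', hu', hv', e'⟩ := h'
  refine ⟨u * u', v * v', mul_ne_zero hu hu', mul_ne_zero hv hv', ?_⟩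
  rw [span_singleton_mul_mul, span_singleton_mul_mul, e, e']

theorem mul_span_pair (u z w : ℂ) :
    Submodule.span ℤ {u} * Submodule.span ℤ {z, w} = Submodule.span ℤ {u * z, u * w} := by
  rw [Submodule.span_mul_span, Set.singleton_mul, Set.image_pair]

theorem span_pair_le {z w : ℂ} {L : Submodule ℤ ℂ} (hz : z ∈ L) (hw : w ∈ L) :
    Submodule.span ℤ {z, w} ≤ L := by
  rw [Submodule.span_le]
  rintro t (rfl | rfl)
  · exact hz
  · exact hw

theorem mem_pair {z w t : ℂ} (x y : ℤ) (h : x * z + y * w = t) :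
    t ∈ Submodule.span ℤ {z, w} := by
  rw [Submodule.mem_span_pair]
  exact ⟨x, y, by simpa using h⟩

theorem cast_disc (f : Form D) : (f.b : ℂ) ^ 2 - 4 * f.a * f.c = D := by
  exact_mod_cast congrArg (Int.cast : ℤ → ℂ) f.disc

theorem lat_eq_of_modEq (f : Form D) {B : ℤ} (h : B ≡ f.b [ZMOD 2 * f.a]) :
    f.lat = Submodule.span ℤ {(2 * f.a : ℂ), -B + rt D} := by
  obtain ⟨k, hk⟩ := h.dvd
  have hk' : (f.b : ℂ) - B = 2 * f.a * k := by exact_mod_cast congrArg (Int.cast : ℤ → ℂ) hk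
  rw [lat]
  apply le_antisymm
  · exact span_pair_le (mem_pair 1 0 (by push_cast; ring))
      (mem_pair (-k) 1 (by push_cast; linear_combination hk'))
  · exact span_pair_le (mem_pair 1 0 (by push_cast; ring))
      (mem_pair k 1 (by push_cast; linear_combination -hk'))

variable [hD : NegDisc D]

theorem Equiv.homothetic {f g : Form D} (h : f.Equiv g) : Homothetic f.lat g.lat := by
  obtain ⟨p, q, r, s, hd, ha, hb, hc⟩ := (equiv_iff f g).1 h
  have hδ := rt_sq (D := D)
  have hg := cast_disc g
  have ha' : (f.a : ℂ) = g.a * p ^ 2 + g.b * p * r + g.c * r ^ 2 := by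
    rw [ha, eval]; push_cast; ring
  have hb' : (f.b : ℂ) = 2 * g.a * p * q + g.b * (p * s + q * r) + 2 * g.c * r * s := by
    rw [hb]; push_cast; ring
  have hd' : (p : ℂ) * s - q * r = 1 := by exact_mod_cast congrArg (Int.cast : ℤ → ℂ) hd
  have hfa : (f.a : ℂ) ≠ 0 := by exact_mod_cast f.pos.ne'
  -- the two generators of the first lattice, in terms of those of the second
  have e1 : ((2 * g.a * p - r * (-g.b + rt D)) : ℂ) * (2 * f.a) =
      (2 * f.a) * (p * (2 * g.a) - r * (-g.b + rt D)) := by ring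
  have e2 : ((2 * g.a * p - r * (-g.b + rt D)) : ℂ) * (-f.b + rt D) =
      (2 * f.a) * (s * (-g.b + rt D) - q * (2 * g.a)) := by
    rw [ha', hb']
    linear_combination (-(r : ℂ)) * hδ + (-(2 * g.a * p + r * g.b) * rt D + r * D) * hd' +
      (r * (p * s - q * r) : ℂ) * hg
  refine ⟨2 * g.a * p - r * (-g.b + rt D), 2 * f.a, ?_, by simpa using hfa, ?_⟩
  · intro h0
    rw [h0, zero_mul] at e1 e2
    have e1' := (mul_eq_zero.1 e1.symm).resolve_left (by simpa using hfa)
    have e2' := (mul_eq_zero.1 e2.symm).resolve_left (by simpa using hfa)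
    have : (-g.b + rt D : ℂ) = 0 := by
      linear_combination (q : ℂ) * e1' + (p : ℂ) * e2' - (-g.b + rt D) * hd'
    have := (rt_indep (D := D) (x := -g.b) (y := 1) (z := 0) (w := 0)
      (by push_cast; linear_combination this)).2
    omega
  · rw [lat, lat, mul_span_pair, mul_span_pair, e1, e2]
    apply le_antisymm
    · exact span_pair_le (mem_pair p (-r) (by push_cast; ring))
        (mem_pair (-q) s (by push_cast; ring))
    · refine span_pair_le (mem_pair s r ?_) (mem_pair q p ?_)
      · linear_combination (2 * f.a * (2 * g.a) : ℂ) * hd'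
      · linear_combination (2 * f.a * (-g.b + rt D) : ℂ) * hd'

theorem equiv_of_homothetic {f g : Form D} (h : Homothetic f.lat g.lat) : f.Equiv g := by
  obtain ⟨u, v, hu, hv, e⟩ := h
  rw [lat, lat, mul_span_pair, mul_span_pair] at e
  have hδ := rt_sq (D := D)
  have m1 : u * (2 * f.a) ∈ Submodule.span ℤ {v * (2 * g.a), v * (-g.b + rt D)} := by
    rw [← e]; exact Submodule.subset_span (by simp)
  have m2 : u * (-f.b + rt D) ∈ Submodule.span ℤ {v * (2 * g.a), v * (-g.b + rt D)} := by
    rw [← e]; exact Submodule.subset_span (by simp)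
  have m3 : v * (2 * g.a) ∈ Submodule.span ℤ {u * (2 * f.a), u * (-f.b + rt D)} := by
    rw [e]; exact Submodule.subset_span (by simp)
  have m4 : v * (-g.b + rt D) ∈ Submodule.span ℤ {u * (2 * f.a), u * (-f.b + rt D)} := by
    rw [e]; exact Submodule.subset_span (by simp)
  rw [Submodule.mem_span_pair] at m1 m2 m3 m4
  obtain ⟨x, y, h1⟩ := m1
  obtain ⟨z, w, h2⟩ := m2
  obtain ⟨x', y', h3⟩ := m3
  obtain ⟨z', w', h4⟩ := m4
  simp only [zsmul_eq_mul] at h1 h2 h3 h4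
  have hga : g.a ≠ 0 := g.pos.ne'
  have hfa : f.a ≠ 0 := f.pos.ne'
  -- the two coordinate matrices are inverse to each other
  have k1 : (2 * g.a : ℂ) = (x' * x + y' * z) * (2 * g.a) + (x' * y + y' * w) * (-g.b + rt D) := by
    apply mul_left_cancel₀ hv
    linear_combination -h3 - (x' : ℂ) * h1 - (y' : ℂ) * h2
  have k2 : (-g.b + rt D : ℂ) =
      (z' * x + w' * z) * (2 * g.a) + (z' * y + w' * w) * (-g.b + rt D) := by
    apply mul_left_cancel₀ hv
    linear_combination -h4 - (z' : ℂ) * h1 - (w' : ℂ) * h2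
  have k1' := rt_indep (D := D) (x := 2 * g.a) (y := 0)
    (z := (x' * x + y' * z) * (2 * g.a) - (x' * y + y' * w) * g.b) (w := x' * y + y' * w)
    (by push_cast; linear_combination k1)
  have k2' := rt_indep (D := D) (x := -g.b) (y := 1)
    (z := (z' * x + w' * z) * (2 * g.a) - (z' * y + w' * w) * g.b) (w := z' * y + w' * w)
    (by push_cast; linear_combination k2)
  have i1 : x' * x + y' * z = 1 := by
    apply mul_right_cancel₀ (mul_ne_zero two_ne_zero hga)
    linear_combination -k1'.1 - g.b * k1'.2
  have i2 : z' * x + w' * z = 0 := by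
    apply mul_right_cancel₀ (mul_ne_zero two_ne_zero hga)
    linear_combination -k2'.1 - g.b * k2'.2
  have hdet : (x * w - y * z) * (x' * w' - y' * z') = 1 := by
    linear_combination (z' * y + w' * w) * i1 - k2'.2 - (x' * y + y' * w) * i2
  have hdet' : x * w - y * z = 1 ∨ x * w - y * z = -1 := Int.eq_one_or_neg_one_of_mul_eq_one hdet
  -- comparison of coordinates
  have k3 : (-f.b + rt D : ℂ) * (x * (2 * g.a) + y * (-g.b + rt D)) =
      2 * f.a * (z * (2 * g.a) + w * (-g.b + rt D)) := by
    apply mul_left_cancel₀ (mul_ne_zero hu hv)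
    linear_combination (u * (-f.b + rt D)) * h1 - (u * (2 * f.a)) * h2
  obtain ⟨k4, k5⟩ := rt_indep (D := D) (x := -f.b * (2 * g.a * x - g.b * y) + y * D)
    (y := 2 * g.a * x - g.b * y - f.b * y) (z := 2 * f.a * (2 * g.a * z - g.b * w))
    (w := 2 * f.a * w) (by push_cast; linear_combination k3 - (y : ℂ) * hδ)
  have hgd := g.disc
  have hfd := f.disc
  have k6 : f.a * (x * w - y * z) = g.eval x (-y) := by
    apply mul_left_cancel₀ (mul_ne_zero four_ne_zero hga)
    rw [eval]
    linear_combination (-2 * g.a * x + g.b * y) * k5 + y * k4 + y ^ 2 * hgd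
  have k7 : 0 ≤ 4 * g.a * g.eval x (-y) := by
    have : 4 * g.a * g.eval x (-y) = (2 * g.a * x - g.b * y) ^ 2 + (-D) * y ^ 2 := by
      rw [eval]; linear_combination - y ^ 2 * hgd
    rw [this]
    have := hD.neg
    have : 0 ≤ -D := by omega
    positivity
  have hd1 : x * w - y * z = 1 := by
    rcases hdet' with h | h
    · exact h
    · rw [← k6, h] at k7
      have := f.pos
      have := g.pos
      nlinarith [mul_pos f.pos g.pos]
  rw [hd1, mul_one] at k6
  have k8 : f.b = 2 * g.a * x * (-z) + g.b * (x * w + (-z) * (-y)) + 2 * g.c * (-y) * w := by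
    rw [eval] at k6
    apply mul_left_cancel₀ (mul_ne_zero two_ne_zero hga)
    linear_combination (-w) * k4 + (2 * g.a * z - g.b * w) * k5 - 2 * g.a * f.b * hd1
      - y * w * hgd
  refine (equiv_iff f g).2 ⟨x, -z, -y, w, by linear_combination hd1, k6, k8, ?_⟩
  apply mul_left_cancel₀ (mul_ne_zero four_ne_zero hfa)
  have k9 : 4 * g.eval x (-y) * g.eval (-z) w =
      (2 * g.a * x * (-z) + g.b * (x * w + (-z) * (-y)) + 2 * g.c * (-y) * w) ^ 2 - D := by
    simp only [eval]
    linear_combination (-(x * w - y * z) ^ 2) * hgd - D * (x * w - y * z + 1) * hd1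
  rw [k8] at hfd
  rw [← k6] at k9
  linear_combination -k9 - hfd

theorem IsDirichletComposition.lat_mul {f g h : Form D} (H : IsDirichletComposition f g h) :
    Homothetic (f.lat * g.lat) h.lat := by
  obtain ⟨hgcd, ha, hf, hg⟩ := H
  have hδ := rt_sq (D := D)
  have hh := cast_disc h
  have ha' : (h.a : ℂ) = f.a * g.a := by exact_mod_cast congrArg (Int.cast : ℤ → ℂ) ha
  -- a Bezout relation
  obtain ⟨s, t, m, hbez⟩ : ∃ s t m : ℤ, s * f.a + t * g.a + m * h.b = 1 := by
    obtain ⟨k, hk⟩ := hf.dvd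
    obtain ⟨l, hl⟩ := hg.dvd
    have hmid : (f.b + g.b) / 2 = h.b + f.a * k + g.a * l := by
      rw [show f.b + g.b = 2 * (h.b + f.a * k + g.a * l) by linear_combination hk + hl]
      exact Int.mul_ediv_cancel_left _ two_ne_zero
    rw [hmid] at hgcd
    obtain ⟨s, t, hst⟩ : ∃ s t : ℤ, (Int.gcd f.a g.a : ℤ) = f.a * s + g.a * t :=
      ⟨_, _, Int.gcd_eq_gcd_ab f.a g.a⟩
    obtain ⟨m, n, hmn⟩ : ∃ m n : ℤ, (1 : ℤ) =
        (Int.gcd f.a g.a : ℤ) * m + (h.b + f.a * k + g.a * l) * n :=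
      ⟨_, _, by rw [← Int.gcd_eq_gcd_ab, hgcd, Nat.cast_one]⟩
    exact ⟨s * m + k * n, t * m + l * n, n, by linear_combination -hmn - m * hst⟩
  have hbez' : (s : ℂ) * f.a + t * g.a + m * h.b = 1 := by
    exact_mod_cast congrArg (Int.cast : ℤ → ℂ) hbez
  refine ⟨1, 2, one_ne_zero, two_ne_zero, ?_⟩
  rw [lat_eq_of_modEq f hf, lat_eq_of_modEq g hg, ← Submodule.one_eq_span, one_mul,
    lat, mul_span_pair]
  apply le_antisymm
  · rw [Submodule.span_mul_span, Submodule.span_le]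
    rintro z ⟨z₁, (rfl | rfl), z₂, (rfl | rfl), rfl⟩
    · exact mem_pair 1 0 (by push_cast; rw [ha']; ring)
    · exact mem_pair 0 f.a (by push_cast; ring)
    · exact mem_pair 0 g.a (by push_cast; ring)
    · exact mem_pair (-h.c) (-h.b) (by push_cast; linear_combination -hδ + hh)
  · have sm : ∀ x ∈ ({(2 * f.a : ℂ), -h.b + rt D} : Set ℂ),
        ∀ y ∈ ({(2 * g.a : ℂ), -h.b + rt D} : Set ℂ),
        x * y ∈ Submodule.span ℤ {(2 * f.a : ℂ), -h.b + rt D} *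
          Submodule.span ℤ {(2 * g.a : ℂ), -h.b + rt D} :=
      fun x hx y hy => Submodule.mul_mem_mul (Submodule.subset_span hx) (Submodule.subset_span hy)
    have s1 := sm (2 * f.a) (by simp) (2 * g.a) (by simp)
    have s2 := sm (2 * f.a) (by simp) (-h.b + rt D) (by simp)
    have s3 := sm (-h.b + rt D) (by simp) (2 * g.a) (by simp)
    have s4 := sm (-h.b + rt D) (by simp) (-h.b + rt D) (by simp)
    refine span_pair_le ?_ ?_
    · convert s1 using 1
      rw [ha']; ring
    · convert add_mem (add_mem (Submodule.smul_mem _ s s2) (Submodule.smul_mem _ t s3))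
        (add_mem (Submodule.smul_mem _ (-m) s4) (Submodule.smul_mem _ (-m * h.c) s1)) using 1
      simp only [zsmul_eq_mul]
      push_cast
      linear_combination (-2 * (-h.b + rt D : ℂ)) * hbez' + (m : ℂ) * hδ - (m : ℂ) * hh -
        4 * m * h.c * ha'

/-- Dirichlet composition is well defined on equivalence classes. -/
theorem IsDirichletComposition.equiv {f g h f' g' h' : Form D}
    (H : IsDirichletComposition f g h) (H' : IsDirichletComposition f' g' h')
    (hf : f.Equiv f') (hg : g.Equiv g') : h.Equiv h' :=
  equiv_of_homothetic
    ((H.lat_mul.symm.trans (hf.homothetic.mul hg.homothetic)).trans H'.lat_mul)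

end Lattice

/-! ### Existence of compositions -/

theorem b_emod (f : Form D) : f.b % 2 = D % 2 := by
  have h := f.disc
  have : D = f.b * f.b - 2 * (2 * (f.a * f.c)) := by linear_combination -h
  rcases Int.emod_two_eq_zero_or_one f.b with h0 | h0 <;>
  · have h1 := Int.mul_emod f.b f.b 2
    rw [h0] at h1
    omega

/-- The form `f(px + qy, rx + sy)` for `ps - qr = 1`. -/
theorem exists_subst [hD : NegDisc D] (f : Form D) {p q r s : ℤ} (h : p * s - q * r = 1) :
    ∃ g : Form D, g.Equiv f ∧ g.a = f.eval p r ∧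
      g.b = 2 * f.a * p * q + f.b * (p * s + q * r) + 2 * f.c * r * s := by
  have hd := f.disc
  have h0 : 0 ≤ 4 * f.a * f.eval p r := by
    have : 4 * f.a * f.eval p r = (2 * f.a * p + f.b * r) ^ 2 + (-D) * r ^ 2 := by
      rw [eval]; linear_combination - r ^ 2 * hd
    rw [this]
    have := hD.neg
    have : 0 ≤ -D := by omega
    positivity
  have hdisc : (2 * f.a * p * q + f.b * (p * s + q * r) + 2 * f.c * r * s) ^ 2
      - 4 * f.eval p r * f.eval q s = D := by
    simp only [eval]
    linear_combination (p * s - q * r) ^ 2 * hd + D * (p * s - q * r + 1) * h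
  refine ⟨⟨f.eval p r, 2 * f.a * p * q + f.b * (p * s + q * r) + 2 * f.c * r * s, f.eval q s,
    hdisc, ?_, ?_⟩, ?_, rfl, rfl⟩
  · -- the coefficients of `f` are integral combinations of the new ones
    set A := f.eval p r with hA
    set B := 2 * f.a * p * q + f.b * (p * s + q * r) + 2 * f.c * r * s with hB
    set C := f.eval q s with hC
    have ea : f.a = A * s ^ 2 - B * s * r + C * r ^ 2 := by
      simp only [hA, hB, hC, eval]
      linear_combination (-f.a * (p * s - q * r + 1)) * h
    have eb : f.b = -2 * A * s * q + B * (p * s + q * r) - 2 * C * p * r := by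
      simp only [hA, hB, hC, eval]
      linear_combination (-f.b * (p * s - q * r + 1)) * h
    have ec : f.c = A * q ^ 2 - B * q * p + C * p ^ 2 := by
      simp only [hA, hB, hC, eval]
      linear_combination (-f.c * (p * s - q * r + 1)) * h
    have dA : ((Int.gcd (Int.gcd A B) C : ℕ) : ℤ) ∣ A :=
      (Int.gcd_dvd_left ..).trans (Int.gcd_dvd_left ..)
    have dB : ((Int.gcd (Int.gcd A B) C : ℕ) : ℤ) ∣ B :=
      (Int.gcd_dvd_left ..).trans (Int.gcd_dvd_right ..)
    have dC : ((Int.gcd (Int.gcd A B) C : ℕ) : ℤ) ∣ C := Int.gcd_dvd_right ..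
    generalize Int.gcd (Int.gcd A B) C = d at *
    have da : (d : ℤ) ∣ f.a := by
      rw [ea]
      exact dvd_add (dvd_sub (dA.mul_right _) ((dB.mul_right _).mul_right _)) (dC.mul_right _)
    have db : (d : ℤ) ∣ f.b := by
      rw [eb]
      exact dvd_sub (dvd_add (((dA.mul_left _).mul_right _).mul_right _) (dB.mul_right _))
        (((dC.mul_left _).mul_right _).mul_right _)
    have dc : (d : ℤ) ∣ f.c := by
      rw [ec]
      exact dvd_add (dvd_sub (dA.mul_right _) ((dB.mul_right _).mul_right _)) (dC.mul_right _)
    have := Int.dvd_coe_gcd (Int.dvd_coe_gcd da db) dc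
    rw [f.primitive] at this
    exact Nat.dvd_one.1 (by exact_mod_cast this)
  · have hne : f.eval p r ≠ 0 := by
      intro e
      rw [e] at hdisc
      have := hD.neg
      nlinarith [sq_nonneg (2 * f.a * p * q + f.b * (p * s + q * r) + 2 * f.c * r * s)]
    have := f.pos
    have : 0 ≤ f.eval p r := by
      by_contra hc
      push Not at hc
      nlinarith
    omega
  · exact (equiv_iff _ _).2 ⟨p, q, r, s, h, rfl, rfl, rfl⟩

theorem isCoprime_of_primes {x y : ℤ}
    (h : ∀ l : ℕ, l.Prime → (l : ℤ) ∣ x → ¬ (l : ℤ) ∣ y) : IsCoprime x y := by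
  rw [Int.isCoprime_iff_gcd_eq_one]
  apply Nat.coprime_of_dvd
  intro l hl hx hy
  exact h l hl (Int.natCast_dvd.2 hx) (Int.natCast_dvd.2 hy)

theorem dvd_trans_eq {l x y : ℤ} (h : l ∣ x) (e : x = y) : l ∣ y := e ▸ h

theorem not_dvd_all (f : Form D) {l : ℕ} (hl : l.Prime) (ha : (l : ℤ) ∣ f.a)
    (hb : (l : ℤ) ∣ f.b) (hc : (l : ℤ) ∣ f.c) : False := by
  have := Int.dvd_coe_gcd (Int.dvd_coe_gcd ha hb) hc
  rw [f.primitive] at this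
  exact hl.one_lt.ne' (Nat.dvd_one.1 (by exact_mod_cast this))

/-- A primitive form properly represents a number coprime to a given `N ≠ 0`. -/
theorem exists_coprime_value (f : Form D) {N : ℕ} (hN : N ≠ 0) :
    ∃ p r : ℤ, IsCoprime p r ∧ IsCoprime (f.eval p r) N := by
  classical
  set Q : Finset ℕ := N.primeFactors.filter fun l : ℕ => (l : ℤ) ∣ f.a ∧ ¬ (l : ℤ) ∣ f.c with hQ
  set R : Finset ℕ := N.primeFactors.filter fun l : ℕ => ¬ (l : ℤ) ∣ f.a with hR
  have key : ∀ (S : Finset ℕ), S ⊆ N.primeFactors → ∀ l : ℕ, l.Prime →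
      ((l : ℤ) ∣ ((∏ i ∈ S, i : ℕ) : ℤ) ↔ l ∈ S) := by
    intro S hS l hl
    rw [Int.natCast_dvd_natCast, hl.prime.dvd_finsetProd_iff]
    constructor
    · rintro ⟨i, hi, hd⟩
      rwa [(Nat.prime_dvd_prime_iff_eq hl (Nat.prime_of_mem_primeFactors (hS hi))).1 hd]
    · exact fun h => ⟨l, h, dvd_rfl⟩
  have kQ := key Q (Finset.filter_subset _ _)
  have kR := key R (Finset.filter_subset _ _)
  refine ⟨((∏ i ∈ Q, i : ℕ) : ℤ), ((∏ i ∈ R, i : ℕ) : ℤ), ?_, ?_⟩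
  · apply isCoprime_of_primes
    intro l hl h1 h2
    rw [kQ l hl, hQ, Finset.mem_filter] at h1
    rw [kR l hl, hR, Finset.mem_filter] at h2
    exact h2.2 h1.2.1
  · apply isCoprime_of_primes
    intro l hl h1 h2
    have hlN : l ∈ N.primeFactors := Nat.mem_primeFactors.2 ⟨hl, by exact_mod_cast h2, hN⟩
    have eQ := kQ l hl
    have eR := kR l hl
    rw [hQ, Finset.mem_filter] at eQ
    rw [hR, Finset.mem_filter] at eR
    generalize ((∏ i ∈ Q, i : ℕ) : ℤ) = p at *
    generalize ((∏ i ∈ R, i : ℕ) : ℤ) = r at *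
    have hp : Prime (l : ℤ) := Nat.prime_iff_prime_int.1 hl
    rw [eval] at h1
    by_cases ha : (l : ℤ) ∣ f.a
    · have nr : ¬ (l : ℤ) ∣ r := fun h => (eR.1 h).2 ha
      by_cases hc : (l : ℤ) ∣ f.c
      · have np : ¬ (l : ℤ) ∣ p := fun h => (eQ.1 h).2.2 hc
        have h3 : (l : ℤ) ∣ f.b * p * r := by
          have := dvd_sub (dvd_sub h1 (ha.mul_right (p ^ 2))) (hc.mul_right (r ^ 2))
          refine dvd_trans_eq this ?_
          ring
        rcases hp.dvd_or_dvd h3 with h3 | h3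
        · rcases hp.dvd_or_dvd h3 with h3 | h3
          · exact f.not_dvd_all hl ha h3 hc
          · exact np h3
        · exact nr h3
      · have dp : (l : ℤ) ∣ p := eQ.2 ⟨hlN, ha, hc⟩
        have h3 : (l : ℤ) ∣ f.c * r ^ 2 := by
          have := dvd_sub h1 (dp.mul_right (f.a * p + f.b * r))
          refine dvd_trans_eq this ?_
          ring
        rcases hp.dvd_or_dvd h3 with h3 | h3
        · exact hc h3
        · exact nr (hp.dvd_of_dvd_pow h3)
    · have dr : (l : ℤ) ∣ r := eR.2 ⟨hlN, ha⟩
      have np : ¬ (l : ℤ) ∣ p := fun h => ha (eQ.1 h).2.1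
      have h3 : (l : ℤ) ∣ f.a * p ^ 2 := by
        have := dvd_sub h1 (dr.mul_right (f.b * p + f.c * r))
        refine dvd_trans_eq this ?_
        ring
      rcases hp.dvd_or_dvd h3 with h3 | h3
      · exact ha h3
      · exact np (hp.dvd_of_dvd_pow h3)

/-- Two forms with coprime leading coefficients have a Dirichlet composition. -/
theorem exists_composition_of_isCoprime (f g : Form D) (h : IsCoprime f.a g.a) :
    ∃ k : Form D, IsDirichletComposition f g k := by
  obtain ⟨u, v, huv⟩ := h
  obtain ⟨m, hm⟩ : ∃ m, g.b - f.b = 2 * m := by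
    have h1 := f.b_emod
    have h2 := g.b_emod
    exact ⟨(g.b - f.b) / 2, by omega⟩
  have hf := f.disc
  have hg := g.disc
  obtain ⟨B, hB⟩ : ∃ B, B = f.b + 2 * f.a * (u * m) := ⟨_, rfl⟩
  have hB' : B = g.b - 2 * g.a * (v * m) := by
    linear_combination hB - hm + 2 * m * huv
  obtain ⟨X, hX⟩ : ∃ X, X = f.c + u * m * f.b + f.a * (u * m) ^ 2 := ⟨_, rfl⟩
  obtain ⟨Y, hY⟩ : ∃ Y, Y = g.c - v * m * g.b + g.a * (v * m) ^ 2 := ⟨_, rfl⟩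
  have hBX : B ^ 2 - D = 4 * f.a * X := by rw [hB, hX]; linear_combination hf
  have hBY : B ^ 2 - D = 4 * g.a * Y := by rw [hB', hY]; linear_combination hg
  have hXY : f.a * X = g.a * Y := by linarith
  have hXC : X = g.a * (u * Y + v * X) := by linear_combination (-X) * huv + u * hXY
  have hYC : Y = f.a * (u * Y + v * X) := by linear_combination (-Y) * huv - v * hXY
  generalize u * Y + v * X = C at hXC hYC
  have hcop : Int.gcd f.a g.a = 1 := Int.isCoprime_iff_gcd_eq_one.1 ⟨u, v, huv⟩
  have hprim : Int.gcd (Int.gcd (f.a * g.a) B) C = 1 := by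
    rw [← Int.isCoprime_iff_gcd_eq_one]
    apply isCoprime_of_primes
    intro l hl h1 hC
    have hA : (l : ℤ) ∣ f.a * g.a := h1.trans (Int.gcd_dvd_left ..)
    have hlB : (l : ℤ) ∣ B := h1.trans (Int.gcd_dvd_right ..)
    rcases (Nat.prime_iff_prime_int.1 hl).dvd_or_dvd hA with ha | ha
    · have db : (l : ℤ) ∣ f.b := by
        have := dvd_sub hlB (ha.mul_right (2 * (u * m)))
        refine dvd_trans_eq this ?_
        rw [hB]; ring
      refine f.not_dvd_all hl ha db ?_
      have := dvd_sub (dvd_sub (hC.mul_left g.a) (db.mul_left (u * m)))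
        (ha.mul_right ((u * m) ^ 2))
      refine dvd_trans_eq this ?_
      rw [← hXC, hX]; ring
    · have db : (l : ℤ) ∣ g.b := by
        have := dvd_add hlB (ha.mul_right (2 * (v * m)))
        refine dvd_trans_eq this ?_
        rw [hB']; ring
      refine g.not_dvd_all hl ha db ?_
      have := dvd_sub (dvd_add (hC.mul_left f.a) (db.mul_left (v * m)))
        (ha.mul_right ((v * m) ^ 2))
      refine dvd_trans_eq this ?_
      rw [← hYC, hY]; ring
  refine ⟨⟨f.a * g.a, B, C, ?_, hprim, mul_pos f.pos g.pos⟩, ?_, rfl, ?_, ?_⟩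
  · linear_combination hBX + 4 * f.a * hXC
  · rw [hcop]; simp
  · exact Int.modEq_iff_dvd.2 ⟨-(u * m), by change f.b - B = _; linear_combination -hB⟩
  · exact Int.modEq_iff_dvd.2 ⟨v * m, by change g.b - B = _; linear_combination -hB'⟩

/-- Any two classes contain forms that have a Dirichlet composition. -/
theorem exists_composition [NegDisc D] (f g : Form D) :
    ∃ f' g' h : Form D, f'.Equiv f ∧ g'.Equiv g ∧ IsDirichletComposition f' g' h := by
  obtain ⟨p, r, ⟨s, q, hpr⟩, hc⟩ := g.exists_coprime_value (N := f.a.natAbs)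
    (Int.natAbs_ne_zero.2 f.pos.ne')
  obtain ⟨g', hg', ha, -⟩ := g.exists_subst (p := p) (q := -q) (r := r) (s := s)
    (by linear_combination hpr)
  have : (f.a.natAbs : ℤ) = f.a := Int.natAbs_of_nonneg f.pos.le
  rw [this, ← ha] at hc
  obtain ⟨h, hh⟩ := exists_composition_of_isCoprime f g' hc.symm
  exact ⟨f, g', h, equiv_refl f, hg', hh⟩

/-- The principal form: `(1, 0, -D/4)` if `D ≡ 0 (mod 4)`, and `(1, 1, (1 - D)/4)` if
`D ≡ 1 (mod 4)`. -/
def principal (D : ℤ) [h : NegDisc D] : Form D where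
  a := 1
  b := D % 2
  c := (D % 2 - D) / 4
  disc := by
    rcases h.mod_four with h | h
    · rw [show D % 2 = 0 by omega]; omega
    · rw [show D % 2 = 1 by omega]; omega
  primitive := by simp
  pos := one_pos

/-- The opposite form `(a, -b, c)`. -/
def opposite (f : Form D) : Form D where
  a := f.a
  b := -f.b
  c := f.c
  disc := by have := f.disc; linear_combination this
  primitive := by rw [Int.gcd_neg]; exact f.primitive
  pos := f.pos

theorem Equiv.opposite {f g : Form D} (h : f.Equiv g) : f.opposite.Equiv g.opposite := by
  obtain ⟨p, q, r, s, hd, ha, hb, hc⟩ := (equiv_iff f g).1 h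
  refine (equiv_iff _ _).2 ⟨p, -q, -r, s, by linear_combination hd, ?_, ?_, ?_⟩
  · simp only [Form.opposite, eval] at ha ⊢; linear_combination ha
  · simp only [Form.opposite] at hb ⊢; linear_combination -hb
  · simp only [Form.opposite, eval] at hc ⊢; linear_combination hc

theorem principal_composition [NegDisc D] (f : Form D) :
    IsDirichletComposition (principal D) f f := by
  refine ⟨by simp [principal], by simp [principal], ?_, Int.ModEq.refl _⟩
  have := f.b_emod
  simp only [principal, mul_one]
  rw [Int.ModEq]
  omega

theorem opposite_composition [hD : NegDisc D] (f : Form D) :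
    ∃ f' h : Form D, f'.Equiv f.opposite ∧ h.Equiv (principal D) ∧
      IsDirichletComposition f' f h := by
  have hd := f.disc
  have hc : 0 < f.c := by
    have := hD.neg
    have := f.pos
    by_contra hc
    push Not at hc
    nlinarith [sq_nonneg f.b, mul_nonneg f.pos.le (neg_nonneg.2 hc)]
  have hprim : Int.gcd (Int.gcd f.c f.b) f.a = 1 := by
    have := f.primitive
    rwa [Int.gcd_assoc, Int.gcd_comm, Int.gcd_comm f.b f.c] at this
  obtain ⟨k, hk⟩ : ∃ k, f.b + D % 2 = 2 * k := by
    have := f.b_emod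
    exact ⟨(f.b + D % 2) / 2, by omega⟩
  refine ⟨⟨f.c, f.b, f.a, by linear_combination hd, hprim, hc⟩,
    ⟨f.c * f.a, f.b, 1, by linear_combination hd, by simp, mul_pos hc f.pos⟩, ?_, ?_, ?_⟩
  · refine (equiv_iff _ _).2 ⟨0, -1, 1, 0, by norm_num, ?_, ?_, ?_⟩ <;>
      simp [opposite, eval]
  · have he := (principal D).disc
    have ha : (principal D).a = 1 := rfl
    have hb : (principal D).b = D % 2 := rfl
    refine (equiv_iff _ _).2 ⟨k, 1, -1, 0, by norm_num, ?_, ?_, ?_⟩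
    · apply mul_left_cancel₀ (four_ne_zero (α := ℤ))
      simp only [eval]
      rw [ha, hb] at he ⊢
      linear_combination (-1) * hd + he + (f.b - D % 2 + 2 * k) * hk
    · simp only [ha, hb]
      linear_combination hk
    · simp [eval, ha]
  · refine ⟨?_, rfl, Int.ModEq.refl _, Int.ModEq.refl _⟩
    have : (f.b + f.b) / 2 = f.b := by omega
    simp only [this]
    have := f.primitive
    rwa [Int.gcd_comm f.c f.a, Int.gcd_assoc, Int.gcd_comm f.c f.b, ← Int.gcd_assoc]

end Form

/-- The set `C(D)` of equivalence classes of primitive (positive definite) forms of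
discriminant `D`. -/
def FormClass (D : ℤ) : Type := Quotient (Form.setoid D)

namespace FormClass

variable {D : ℤ}

/-- The class of a form. -/
def mk (f : Form D) : FormClass D := Quotient.mk _ f

theorem mk_eq {f g : Form D} : mk f = mk g ↔ f.Equiv g := Quotient.eq

theorem exists_rep (x : FormClass D) : ∃ f : Form D, mk f = x := Quotient.exists_rep x

/-- `x` is derived from `y`: some form of `x` is derived from some form of `y`. -/
def IsDerived {D' : ℤ} (r : ℤ) (x : FormClass D') (y : FormClass D) : Prop :=
  ∃ (f : Form D') (g : Form D), mk f = x ∧ mk g = y ∧ Form.IsDerived r f g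

variable [NegDisc D]

theorem exists_mul (x y : FormClass D) : ∃ z : FormClass D, ∃ f g h : Form D,
    mk f = x ∧ mk g = y ∧ mk h = z ∧ Form.IsDirichletComposition f g h := by
  obtain ⟨f, rfl⟩ := exists_rep x
  obtain ⟨g, rfl⟩ := exists_rep y
  obtain ⟨f', g', h, hf, hg, H⟩ := Form.exists_composition f g
  exact ⟨mk h, f', g', h, mk_eq.2 hf, mk_eq.2 hg, rfl, H⟩

/-- The product of two classes is the class of any Dirichlet composition of two of their forms
(see `mk_mul_mk` for the independence of choices). -/
noncomputable instance : Mul (FormClass D) := ⟨fun x y => (exists_mul x y).choose⟩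

theorem mk_mul_mk {f g h : Form D} (H : Form.IsDirichletComposition f g h) :
    mk f * mk g = mk h := by
  obtain ⟨f', g', h', hf, hg, hh, H'⟩ := (exists_mul (mk f) (mk g)).choose_spec
  exact hh.symm.trans (mk_eq.2 (H'.equiv H (mk_eq.1 hf) (mk_eq.1 hg)))

instance : One (FormClass D) := ⟨mk (Form.principal D)⟩

instance : Inv (FormClass D) :=
  ⟨Quotient.map Form.opposite fun _ _ h => Form.Equiv.opposite h⟩

theorem lat_of_mul {f g h : Form D} (e : mk f * mk g = mk h) :
    Form.Homothetic (f.lat * g.lat) h.lat := by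
  obtain ⟨f', g', h', hf, hg, hh, H⟩ := (exists_mul (mk f) (mk g)).choose_spec
  have hh' : mk h' = mk h := hh.trans e
  exact (((mk_eq.1 hf).homothetic.mul (mk_eq.1 hg).homothetic).symm.trans H.lat_mul).trans
    (mk_eq.1 hh').homothetic

/-- The class group `C(D)`. -/
noncomputable instance : CommGroup (FormClass D) where
  mul_assoc x y z := by
    obtain ⟨f, rfl⟩ := exists_rep x
    obtain ⟨g, rfl⟩ := exists_rep y
    obtain ⟨h, rfl⟩ := exists_rep z
    obtain ⟨k, hk⟩ := exists_rep (mk f * mk g)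
    obtain ⟨l, hl⟩ := exists_rep (mk g * mk h)
    obtain ⟨m, hm⟩ := exists_rep (mk k * mk h)
    obtain ⟨n, hn⟩ := exists_rep (mk f * mk l)
    rw [← hk, ← hl, ← hm, ← hn, mk_eq]
    apply Form.equiv_of_homothetic
    have h1 := lat_of_mul hk.symm
    have h2 := lat_of_mul hl.symm
    have h3 := lat_of_mul hm.symm
    have h4 := lat_of_mul hn.symm
    refine (((h1.mul (.of_eq rfl)).trans h3).symm.trans (.of_eq (mul_assoc _ _ _))).trans ?_
    exact ((Form.Homothetic.of_eq rfl).mul h2).trans h4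
  mul_comm x y := by
    obtain ⟨f, rfl⟩ := exists_rep x
    obtain ⟨g, rfl⟩ := exists_rep y
    obtain ⟨k, hk⟩ := exists_rep (mk f * mk g)
    obtain ⟨l, hl⟩ := exists_rep (mk g * mk f)
    rw [← hk, ← hl, mk_eq]
    apply Form.equiv_of_homothetic
    exact (lat_of_mul hk.symm).symm.trans ((Form.Homothetic.of_eq (mul_comm _ _)).trans
      (lat_of_mul hl.symm))
  one_mul x := by
    obtain ⟨f, rfl⟩ := exists_rep x
    exact mk_mul_mk f.principal_composition
  mul_one x := by
    obtain ⟨f, rfl⟩ := exists_rep x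
    obtain ⟨k, hk⟩ := exists_rep (mk f * mk (Form.principal D))
    change mk f * mk (Form.principal D) = mk f
    rw [← hk, mk_eq]
    apply Form.equiv_of_homothetic
    exact (lat_of_mul hk.symm).symm.trans ((Form.Homothetic.of_eq (mul_comm _ _)).trans
      f.principal_composition.lat_mul)
  inv_mul_cancel x := by
    obtain ⟨f, rfl⟩ := exists_rep x
    obtain ⟨f', h, hf, hh, H⟩ := f.opposite_composition
    change mk f.opposite * mk f = mk (Form.principal D)
    rw [← mk_eq.2 hf, mk_mul_mk H]
    exact mk_eq.2 hh

/-- Every class contains a form with `|b| ≤ a ≤ c`. -/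
theorem exists_reduced (x : FormClass D) : ∃ f : Form D, mk f = x ∧ |f.b| ≤ f.a ∧ f.a ≤ f.c := by
  obtain ⟨f, hf, hmin⟩ : ∃ f : Form D, mk f = x ∧ ∀ g : Form D, mk g = x → f.a ≤ g.a := by
    obtain ⟨f, hf⟩ := exists_rep x
    obtain ⟨m, ⟨g, hg, hm⟩, hlt⟩ := wellFounded_lt.has_min
      {n : ℕ | ∃ g : Form D, mk g = x ∧ g.a.toNat = n} ⟨_, f, hf, rfl⟩
    refine ⟨g, hg, fun k hk => ?_⟩
    have := hlt k.a.toNat ⟨k, hk, rfl⟩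
    have := k.pos
    have := g.pos
    omega
  have hq : 0 < 2 * f.a := by have := f.pos; omega
  obtain ⟨g, hg, ha, hb⟩ := f.exists_subst (p := 1) (q := -((f.b + f.a) / (2 * f.a))) (r := 0)
    (s := 1) (by ring)
  have hgx : mk g = x := (mk_eq.2 hg).trans hf
  have ha' : g.a = f.a := by rw [ha, Form.eval]; ring
  obtain ⟨k, hk, hka, -⟩ := g.exists_subst (p := 0) (q := -1) (r := 1) (s := 0) (by ring)
  have hkc : k.a = g.c := by rw [hka, Form.eval]; ring
  refine ⟨g, hgx, ?_, ?_⟩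
  · have h1 := Int.emod_nonneg (f.b + f.a) hq.ne'
    have h2 := Int.emod_lt_of_pos (f.b + f.a) hq
    have h3 := Int.emod_add_mul_ediv (f.b + f.a) (2 * f.a)
    have h4 : g.b = (f.b + f.a) % (2 * f.a) - f.a := by
      rw [hb]; linear_combination -h3
    rw [abs_le, ha', h4]
    constructor <;> linarith
  · rw [ha', ← hkc]
    exact hmin k ((mk_eq.2 hk).trans hgx)

/-- The class group is finite. -/
instance : Finite (FormClass D) := by
  choose F hF hb hc using exists_reduced (D := D)
  have key : ∀ x, (F x).a ∈ Set.Icc 0 (-D) ∧ (F x).b ∈ Set.Icc D (-D) := by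
    intro x
    have h1 := (F x).pos
    have h2 := hb x
    have h3 := (F x).disc
    have h5 : (F x).b ^ 2 ≤ (F x).a ^ 2 := sq_le_sq' (by linarith [abs_le.1 h2]) (abs_le.1 h2).2
    have h6 := mul_le_mul_of_nonneg_left (hc x) h1.le
    have h7 : (F x).a ≤ -D := by nlinarith
    rw [abs_le] at h2
    exact ⟨⟨h1.le, h7⟩, by linarith, by linarith⟩
  refine Finite.of_injective
    (fun x => ((⟨_, (key x).1⟩, ⟨_, (key x).2⟩) : Set.Icc 0 (-D) × Set.Icc D (-D))) ?_
  intro x y hxy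
  simp only [Prod.mk.injEq, Subtype.mk.injEq] at hxy
  rw [← hF x, ← hF y]
  congr 1
  refine Form.ext hxy.1 hxy.2 ?_
  have h1 := (F x).disc
  have h2 := (F y).disc
  rw [hxy.1, hxy.2] at h1
  apply mul_left_cancel₀ (mul_ne_zero four_ne_zero (F y).pos.ne')
  linarith

end FormClass

/-- `φ_D(r) = ∏ p^(e - 1) (p - (D/p))`, over the prime powers `p^e` exactly dividing `r`, for odd
`r`. At an odd prime `p` the Kronecker symbol `(D/p)` is the Legendre (Jacobi) symbol. -/
def phi (D : ℤ) (r : ℕ) : ℤ :=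
  ∏ p ∈ r.primeFactors, (p : ℤ) ^ (r.factorization p - 1) * ((p : ℤ) - jacobiSym D p)

end BQF

/-! Everything reduces to a substitution of odd prime determinant `p`. An integral matrix of
determinant `p * m` has a left factor of determinant `p`, so a form derived from `g` with
determinant `p * m` is derived, with determinant `m`, from a form of discriminant `D p²`, itself
derived from `g` with determinant `p` (`Form.IsDerived.exists_factor`). This chain matches the
recursion `phi D (p * r) = (p - (D/p)) * phi (D p²) r` (`phi_prime_mul`).

For a prime `p`, let `O` be the order of discriminant `D`. A form `f` of discriminant `D p²` can be
brought to the shape `(a, p b, p² c)` with `a` prime to `p`. If it is derived from `g`, then `(a, b,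
c)` is equivalent to `g`, and the lattice of `f` times `O` is homothetic to the lattice of `g`
(`homothetic_lat_mul_principal`). Multiplying by `O` respects products, so `f` raised to the order
of `g` is a class that becomes principal over `O`.

Such a class has a lattice homothetic to `ℤ v + p O` with the norm of `v` prime to `p`
(`homothetic_map_lineLattice`). These lattices multiply as their generators do, and `ℤ v + p O`
depends only on `v` modulo `p` and up to integers prime to `p`. By Frobenius, `v ^ (p - (D/p))` is
congruent to such an integer, up to a factor of the same kind (`exists_intCast_mul_pow_eq`). Hence
that power of the class is the class of `ℤ + p O`, the order of discriminant `D p²`, which is the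
identity. -/

namespace BQF

/-! ### Frobenius on quadratic elements in characteristic `p` -/

section Ring

variable {R : Type*} [CommRing R]

theorem intCast_eq_of_zmod {p : ℕ} (hp : (p : R) = 0) {x y : ℤ}
    (h : (x : ZMod p) = y) : (x : R) = y := by
  obtain ⟨k, hk⟩ := (ZMod.intCast_eq_intCast_iff_dvd_sub x y p).1 h
  have := congrArg (Int.cast : ℤ → R) hk
  push_cast at this
  rw [hp, zero_mul] at this
  exact (sub_eq_zero.1 this).symm

theorem exists_intCast_mul_eq_one {p : ℕ} (hp : (p : R) = 0) {m : ℤ} (hm : IsCoprime m p) :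
    ∃ n : R, n * m = 1 := by
  obtain ⟨u, w, h⟩ := hm
  have := congrArg (Int.cast : ℤ → R) h
  push_cast at this
  rw [hp, mul_zero, add_zero] at this
  exact ⟨u, this⟩

/-- The Frobenius on `(X + Y δ) / 2` when `δ² = D`, in characteristic `p`. -/
theorem two_mul_pow_prime {p : ℕ} [Fact p.Prime] (hodd : p ≠ 2) (hp : (p : R) = 0)
    {D X Y : ℤ} {δ v : R} (hδ : δ ^ 2 = D) (hv : 2 * v = X + Y * δ) :
    2 * v ^ p = X + Y * (jacobiSym D p : R) * δ := by
  have hpr : p.Prime := Fact.out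
  have fermat : ∀ x : ℤ, (x : R) ^ p = x := fun x => by
    rw [← Int.cast_pow]
    exact intCast_eq_of_zmod hp (by push_cast; exact ZMod.pow_card _)
  -- Euler's criterion: `δ ^ p = (δ²) ^ ((p - 1) / 2) * δ = D ^ ((p - 1) / 2) * δ`.
  have hδp : δ ^ p = (jacobiSym D p : R) * δ := by
    have h2 : p = 2 * (p / 2) + 1 := by
      have := hpr.eq_two_or_odd
      omega
    have h3 : (jacobiSym D p : R) = ((D ^ (p / 2) : ℤ) : R) := by
      refine intCast_eq_of_zmod hp ?_
      rw [← jacobiSym.legendreSym.to_jacobiSym, legendreSym.eq_pow]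
      push_cast; rfl
    rw [h3]
    conv_lhs => rw [h2, pow_succ, pow_mul, hδ]
    push_cast; rfl
  have h2 : ((2 : ℤ) : R) ^ p = 2 := by simpa using fermat 2
  -- The mixed terms of the binomial expansion are multiples of `p`, hence vanish.
  obtain ⟨r, hr⟩ := exists_add_pow_prime_eq hpr (X : R) (Y * δ)
  rw [← hv, hp, zero_mul, zero_mul, zero_mul, add_zero, mul_pow, mul_pow, fermat, fermat, hδp] at hr
  push_cast at h2
  rw [h2] at hr
  rw [hr]; ring

/-- An element `v = (X + Y δ) / 2` with `δ² = D` whose norm is prime to `p` has its power of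
exponent `p - (D/p)` rational, in characteristic `p`. -/
theorem exists_intCast_mul_pow_eq {p : ℕ} [Fact p.Prime] (hodd : p ≠ 2) (hp : (p : R) = 0)
    {D X Y a : ℤ} {δ v : R} (hδ : δ ^ 2 = D) (hv : 2 * v = X + Y * δ)
    (ha : X ^ 2 - D * Y ^ 2 = 4 * a) (hap : IsCoprime a p) {n : ℕ}
    (hn : (n : ℤ) = p - jacobiSym D p) :
    ∃ m k : ℤ, IsCoprime m p ∧ IsCoprime k p ∧ (m : R) * v ^ n = k := by
  have hpr : p.Prime := Fact.out
  have c2 : IsCoprime (2 : ℤ) p := by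
    rw [← Nat.cast_two, Nat.isCoprime_iff_coprime]
    exact (Nat.coprime_primes Nat.prime_two hpr).2 (Ne.symm hodd)
  have c4 : IsCoprime (4 : ℤ) p := by simpa using c2.mul_left c2
  obtain ⟨h, hh⟩ := exists_intCast_mul_eq_one hp c2
  have key := two_mul_pow_prime hodd hp hδ hv
  have ha' : (X : R) ^ 2 - D * Y ^ 2 = 4 * a := by
    exact_mod_cast congrArg (Int.cast : ℤ → R) ha
  have h1 := hpr.one_lt
  push_cast at hh
  -- Ramified: `2 v^p = X`, and `X² ≡ 4a` is prime to `p`. Split: `v^p = v` with `v` invertible, so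
  -- `v^(p-1) = 1`. Inert: `v^p` is the conjugate of `v`, so `v^(p+1)` is the norm `a`.
  rcases jacobiSym.trichotomy D p with hs | hs | hs
  · refine ⟨2, X, c2, ?_, ?_⟩
    · have hD : (p : ℤ) ∣ D := by
        rw [← jacobiSym.legendreSym.to_jacobiSym] at hs
        exact (ZMod.intCast_zmod_eq_zero_iff_dvd D p).1 ((legendreSym.eq_zero_iff p D).1 hs)
      obtain ⟨d, hd⟩ := hD
      have : IsCoprime (X ^ 2) (p : ℤ) := by
        have h4 := c4.mul_left hap
        rw [← ha, hd] at h4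
        have := h4.add_mul_left_left (d * Y ^ 2)
        rwa [show X ^ 2 - p * d * Y ^ 2 + p * (d * Y ^ 2) = X ^ 2 by ring] at this
      exact (IsCoprime.pow_left_iff two_pos).1 this
    · have : n = p := by rw [hs] at hn; omega
      rw [this]
      rw [hs] at key
      push_cast at key ⊢
      rw [key]; ring
  · refine ⟨1, 1, isCoprime_one_left, isCoprime_one_left, ?_⟩
    have hn' : p = n + 1 := by rw [hs] at hn; omega
    have e : v ^ (n + 1) = v := by
      rw [← hn']
      rw [hs] at key
      push_cast at key
      linear_combination h * key - h * hv + (v - v ^ p) * hh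
    obtain ⟨α, hα⟩ := exists_intCast_mul_eq_one hp hap
    -- `w` is the inverse of `v`
    have hw : v * (α * (X - v)) = 1 := by
      have h4 : 4 * (v * (X - v)) = 4 * a := by
        linear_combination ha' + (2 * X - 2 * v - (X + Y * δ)) * hv - Y ^ 2 * hδ
      linear_combination α * h ^ 2 * h4 + (a * α - α * v * (X - v)) * (2 * h + 1) * hh + hα
    push_cast
    linear_combination (α * (X - v)) * e - (v ^ n - 1) * hw
  · refine ⟨4, 4 * a, c4, c4.mul_left hap, ?_⟩
    have hn' : n = p + 1 := by rw [hs] at hn; omega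
    rw [hn', pow_succ]
    rw [hs] at key
    push_cast at key ⊢
    linear_combination 2 * v * key + (X - Y * δ) * hv + ha' - Y ^ 2 * hδ

/-! ### Multiplication of the lattices `ℤ v + p R` -/

/-- The lattice `ℤ v + p R`. -/
def lineLattice (p : ℕ) (v : R) : Submodule ℤ R :=
  Submodule.span ℤ {v} ⊔ (Ideal.span {(p : R)}).restrictScalars ℤ

theorem mem_lineLattice {p : ℕ} {v x : R} :
    x ∈ lineLattice p v ↔ ∃ (k : ℤ) (z : R), k * v + p * z = x := by
  simp only [lineLattice, Submodule.mem_sup, Submodule.mem_span_singleton,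
    Submodule.restrictScalars_mem]
  constructor
  · rintro ⟨_, ⟨k, rfl⟩, _, ⟨z, rfl⟩, rfl⟩
    exact ⟨k, z, by rw [zsmul_eq_mul]; ring⟩
  · rintro ⟨k, z, rfl⟩
    exact ⟨_, ⟨k, rfl⟩, _, ⟨z, rfl⟩, by rw [zsmul_eq_mul]; ring⟩

/-- One factor must be a unit modulo `p`: otherwise the product need not contain all of `p R`. -/
theorem lineLattice_mul {p : ℕ} {v : R} (hv : IsCoprime v (p : R)) (w : R) :
    lineLattice p v * lineLattice p w = lineLattice p (v * w) := by
  apply le_antisymm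
  · rw [Submodule.mul_le]
    intro x hx y hy
    obtain ⟨k, z, rfl⟩ := mem_lineLattice.1 hx
    obtain ⟨l, t, rfl⟩ := mem_lineLattice.1 hy
    exact mem_lineLattice.2 ⟨k * l, k * v * t + z * (l * w) + p * z * t, by push_cast; ring⟩
  · intro x hx
    obtain ⟨k, z, rfl⟩ := mem_lineLattice.1 hx
    obtain ⟨α, β, h⟩ := hv
    have h1 : k * v + p * 0 ∈ lineLattice p v := mem_lineLattice.2 ⟨k, 0, rfl⟩
    have h2 : (1 : ℤ) * w + p * 0 ∈ lineLattice p w := mem_lineLattice.2 ⟨1, 0, rfl⟩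
    have h3 : (1 : ℤ) * v + p * 0 ∈ lineLattice p v := mem_lineLattice.2 ⟨1, 0, rfl⟩
    have h4 : (0 : ℤ) * w + p * (α * z) ∈ lineLattice p w := mem_lineLattice.2 ⟨0, _, rfl⟩
    have h5 : (0 : ℤ) * v + p * 1 ∈ lineLattice p v := mem_lineLattice.2 ⟨0, _, rfl⟩
    have h6 : (0 : ℤ) * w + p * (β * z) ∈ lineLattice p w := mem_lineLattice.2 ⟨0, _, rfl⟩
    -- With `α v + β p = 1`, the element `p z` splits as `v * (p α z) + p * (p β z)`.
    convert add_mem (Submodule.mul_mem_mul h1 h2)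
      (add_mem (Submodule.mul_mem_mul h3 h4) (Submodule.mul_mem_mul h5 h6)) using 1
    push_cast
    linear_combination (-(p : R) * z) * h

/-- The exponent is positive because the zeroth power is `ℤ`, in general smaller than `ℤ + p R`. -/
theorem lineLattice_pow {p : ℕ} {v : R} (hv : IsCoprime v (p : R)) (n : ℕ) :
    lineLattice p v ^ (n + 1) = lineLattice p (v ^ (n + 1)) := by
  induction n with
  | zero => simp
  | succ n ih => rw [pow_succ', ih, lineLattice_mul hv, ← pow_succ']

/-- Modulo `p`, integers prime to `p` are invertible by integers, so `v` and `1` span the same line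
in `R / p R`. -/
theorem lineLattice_eq_one {p : ℕ} {v z : R} {m k : ℤ} (hm : IsCoprime m p)
    (hk : IsCoprime k p) (h : (m : R) * v = k + p * z) : lineLattice p v = lineLattice p 1 := by
  apply le_antisymm
  · intro x hx
    obtain ⟨l, t, rfl⟩ := mem_lineLattice.1 hx
    obtain ⟨α, β, e⟩ := hm
    have e' : (α : R) * m + β * p = 1 := by exact_mod_cast congrArg (Int.cast : ℤ → R) e
    refine mem_lineLattice.2 ⟨l * α * k, l * (α * z + β * v) + t, ?_⟩
    push_cast
    linear_combination l * v * e' - l * α * h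
  · intro x hx
    obtain ⟨l, t, rfl⟩ := mem_lineLattice.1 hx
    obtain ⟨α, β, e⟩ := hk
    have e' : (α : R) * k + β * p = 1 := by exact_mod_cast congrArg (Int.cast : ℤ → R) e
    refine mem_lineLattice.2 ⟨l * α * m, l * (β - α * z) + t, ?_⟩
    push_cast
    linear_combination l * e' + l * α * h

/-- The norm equation `hav`, which makes `v` a unit modulo `p`, is a separate hypothesis: the other
equations give it only after multiplication by `4`, which need not be cancellable in `R`. -/
theorem lineLattice_pow_eq_one {p : ℕ} [Fact p.Prime] (hodd : p ≠ 2)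
    {D X Y a : ℤ} {δ v : R} (hδ : δ ^ 2 = D) (hv : 2 * v = X + Y * δ)
    (ha : X ^ 2 - D * Y ^ 2 = 4 * a) (hav : v * (X - v) = a) (hap : IsCoprime a p) {n : ℕ}
    (hn : (n : ℤ) = p - jacobiSym D p) : lineLattice p v ^ n = lineLattice p 1 := by
  have hpr : p.Prime := Fact.out
  obtain ⟨n, rfl⟩ : ∃ l, n = l + 1 := by
    refine Nat.exists_eq_succ_of_ne_zero ?_
    rintro rfl
    have := hpr.one_lt
    rcases jacobiSym.trichotomy D p with hs | hs | hs <;> rw [hs] at hn <;> omega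
  have hvp : IsCoprime v (p : R) := by
    have : IsCoprime (a : R) p := by simpa using hap.map (Int.castRingHom R)
    rw [← hav] at this
    exact this.of_mul_left_left
  rw [lineLattice_pow hvp]
  -- The characteristic `p` computation takes place in `R / p R`; its result lifts to `m * v ^ (n +
  -- 1) = k + p * z`.
  let q := Ideal.Quotient.mk (Ideal.span {(p : R)})
  have hq : ((p : ℕ) : R ⧸ Ideal.span {(p : R)}) = 0 := by
    rw [← map_natCast q, Ideal.Quotient.eq_zero_iff_mem]
    exact Ideal.mem_span_singleton_self _
  obtain ⟨m, k, hm, hk, e⟩ := exists_intCast_mul_pow_eq (δ := q δ) (v := q v) hodd hq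
    (by rw [← map_pow, hδ, map_intCast]) (by rw [← map_ofNat q 2, ← map_mul, hv]; simp) ha hap hn
  rw [← map_intCast q, ← map_intCast q, ← map_pow, ← map_mul, Ideal.Quotient.eq,
    Ideal.mem_span_singleton'] at e
  obtain ⟨z, hz⟩ := e
  exact lineLattice_eq_one (z := z) hm hk (by linear_combination -hz)

end Ring

/-! ### Derived forms: factoring a substitution, and normal form at a prime -/

namespace Form

variable {D : ℤ}

theorem isDerived_iff {D' r : ℤ} (f : Form D') (g : Form D) :
    IsDerived r f g ↔ ∃ x y z w : ℤ, x * w - y * z = r ∧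
      f.a = g.eval x z ∧ f.b = 2 * g.a * x * y + g.b * (x * w + y * z) + 2 * g.c * z * w ∧
      f.c = g.eval y w := by
  constructor
  · rintro ⟨A, hd, hA⟩
    refine ⟨A 0 0, A 0 1, A 1 0, A 1 1, ?_, ?_, ?_, ?_⟩
    · rwa [Matrix.det_fin_two] at hd
    · have := hA 1 0; simp [eval] at this ⊢; linarith
    · have h1 := hA 1 1
      have h2 := hA 1 0
      have h3 := hA 0 1
      simp only [eval] at h1 h2 h3 ⊢
      linear_combination h1 - h2 - h3
    · have := hA 0 1; simp [eval] at this ⊢; linarith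
  · rintro ⟨x, y, z, w, h, ha, hb, hc⟩
    refine ⟨!![x, y; z, w], by rw [Matrix.det_fin_two]; simpa using h, fun s t => ?_⟩
    simp only [eval] at ha hc ⊢
    simp only [Matrix.of_apply, Matrix.cons_val', Matrix.cons_val_zero, Matrix.cons_val_one,
      Matrix.cons_val_fin_one]
    rw [ha, hb, hc]; ring

theorem IsDerived.equiv {D' r : ℤ} {f f' : Form D'} {g : Form D} (h : IsDerived r f g)
    (e : f'.Equiv f) : IsDerived r f' g := by
  obtain ⟨A, hd, hA⟩ := h
  obtain ⟨B, hB⟩ := e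
  refine ⟨A * B, by rw [Matrix.det_mul, hd, B.det_coe, mul_one], fun x y => ?_⟩
  rw [hB, hA]
  simp only [Matrix.mul_apply, Fin.sum_univ_two]
  congr 1 <;> ring

theorem equiv_of_isDerived_one {f g : Form D} (h : IsDerived 1 f g) : f.Equiv g :=
  (equiv_iff f g).2 ((isDerived_iff f g).1 h)

/-- A form obtained from a positive definite form by an integral substitution of nonzero
determinant, and from which a primitive form is obtained by a further substitution, is
primitive and positive definite. -/
theorem exists_intermediate [hD : NegDisc D] {D'' : ℤ} (f : Form D'') (g : Form D)
    {n m x y z w x' y' z' w' : ℤ} (hn : n ≠ 0) (hdet : x * w - y * z = n)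
    (hdet' : x' * w' - y' * z' = m)
    (h : ∀ s t, f.eval s t = g.eval (x * (x' * s + y' * t) + y * (z' * s + w' * t))
      (z * (x' * s + y' * t) + w * (z' * s + w' * t))) :
    ∃ k : Form (D * n ^ 2), IsDerived m f k ∧ IsDerived n k g := by
  have hg := g.disc
  set a := g.eval x z with ha
  set b := 2 * g.a * x * y + g.b * (x * w + y * z) + 2 * g.c * z * w with hb
  set c := g.eval y w with hc
  have hdisc : b ^ 2 - 4 * a * c = D * n ^ 2 := by
    rw [hb, ha, hc, ← hdet]
    simp only [eval]
    linear_combination (x * w - y * z) ^ 2 * hg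
  have hneg : D * n ^ 2 < 0 := mul_neg_of_neg_of_pos hD.neg (by positivity)
  have hpos : 0 < a := by
    have h0 : 0 ≤ 4 * g.a * a := by
      have : 4 * g.a * a = (2 * g.a * x + g.b * z) ^ 2 + (-D) * z ^ 2 := by
        rw [ha, eval]; linear_combination - z ^ 2 * hg
      rw [this]
      have := hD.neg
      have : 0 ≤ -D := by omega
      positivity
    have hne : a ≠ 0 := by
      intro e
      rw [e] at hdisc
      nlinarith [sq_nonneg b]
    have := g.pos
    have : 0 ≤ a := by
      by_contra hc
      push Not at hc
      nlinarith
    omega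
  have hk : ∀ s t : ℤ, g.eval (x * s + y * t) (z * s + w * t) =
      a * s ^ 2 + b * s * t + c * t ^ 2 := by
    intro s t
    simp only [ha, hb, hc, eval]
    ring
  have hf : ∀ s t, f.eval s t = a * (x' * s + y' * t) ^ 2 +
      b * (x' * s + y' * t) * (z' * s + w' * t) + c * (z' * s + w' * t) ^ 2 :=
    fun s t => (h s t).trans (hk _ _)
  have fa : f.a = a * x' ^ 2 + b * x' * z' + c * z' ^ 2 := by
    have := hf 1 0
    simp [eval] at this
    exact this
  have fc : f.c = a * y' ^ 2 + b * y' * w' + c * w' ^ 2 := by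
    have := hf 0 1
    simp [eval] at this
    exact this
  have fb : f.b = 2 * a * x' * y' + b * (x' * w' + y' * z') + 2 * c * z' * w' := by
    have := hf 1 1
    simp only [eval] at this
    linear_combination this - fa - fc
  -- The coefficients of `f` are integral combinations of `a`, `b`, `c`, so a common divisor of
  -- these divides the primitive form `f`.
  have hprim : Int.gcd (Int.gcd a b) c = 1 := by
    have dA : ((Int.gcd (Int.gcd a b) c : ℕ) : ℤ) ∣ a :=
      (Int.gcd_dvd_left ..).trans (Int.gcd_dvd_left ..)
    have dB : ((Int.gcd (Int.gcd a b) c : ℕ) : ℤ) ∣ b :=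
      (Int.gcd_dvd_left ..).trans (Int.gcd_dvd_right ..)
    have dC : ((Int.gcd (Int.gcd a b) c : ℕ) : ℤ) ∣ c := Int.gcd_dvd_right ..
    generalize Int.gcd (Int.gcd a b) c = d at *
    obtain ⟨a₀, e₁⟩ := dA
    obtain ⟨b₀, e₂⟩ := dB
    obtain ⟨c₀, e₃⟩ := dC
    rw [e₁, e₂, e₃] at fa fb fc
    have da : (d : ℤ) ∣ f.a := ⟨a₀ * x' ^ 2 + b₀ * x' * z' + c₀ * z' ^ 2, by rw [fa]; ring⟩
    have db : (d : ℤ) ∣ f.b :=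
      ⟨2 * a₀ * x' * y' + b₀ * (x' * w' + y' * z') + 2 * c₀ * z' * w', by rw [fb]; ring⟩
    have dc : (d : ℤ) ∣ f.c := ⟨a₀ * y' ^ 2 + b₀ * y' * w' + c₀ * w' ^ 2, by rw [fc]; ring⟩
    have := Int.dvd_coe_gcd (Int.dvd_coe_gcd da db) dc
    rw [f.primitive] at this
    exact Nat.dvd_one.1 (by exact_mod_cast this)
  refine ⟨⟨a, b, c, hdisc, hprim, hpos⟩, ?_, ?_⟩
  · exact (isDerived_iff _ _).2 ⟨x', y', z', w', hdet', fa, fb, fc⟩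
  · exact (isDerived_iff _ _).2 ⟨x, y, z, w, hdet, rfl, rfl, rfl⟩

/-- An integral matrix whose determinant is divisible by `p` is a multiple, from the right, of
a matrix of determinant `p`. -/
theorem exists_matrix_factor {p : ℕ} (hp : p.Prime) {x y z w m : ℤ}
    (h : x * w - y * z = p * m) :
    ∃ x₁ y₁ z₁ w₁ x₂ y₂ z₂ w₂ : ℤ, x₁ * w₁ - y₁ * z₁ = p ∧ x₂ * w₂ - y₂ * z₂ = m ∧
      x = x₁ * x₂ + y₁ * z₂ ∧ y = x₁ * y₂ + y₁ * w₂ ∧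
      z = z₁ * x₂ + w₁ * z₂ ∧ w = z₁ * y₂ + w₁ * w₂ := by
  have hp0 : (p : ℤ) ≠ 0 := by exact_mod_cast hp.ne_zero
  have hpp : Prime (p : ℤ) := Nat.prime_iff_prime_int.1 hp
  have cop : ∀ t : ℤ, ¬ (p : ℤ) ∣ t → ∃ u v : ℤ, u * t + v * p = 1 := fun t ht =>
    ((Prime.coprime_iff_not_dvd hpp).2 ht).symm
  -- a multiple of the first row is congruent to the second row
  suffices hk : ((p : ℤ) ∣ x ∧ (p : ℤ) ∣ y) ∨ ∃ k, (p : ℤ) ∣ z - k * x ∧ (p : ℤ) ∣ w - k * y by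
    -- The left factor is `!![p, 0; 0, 1]` if `p` divides the first row, and `!![1, 0; k, p]`
    -- otherwise.
    rcases hk with ⟨⟨x', rfl⟩, ⟨y', rfl⟩⟩ | ⟨k, ⟨z', hz⟩, ⟨w', hw⟩⟩
    · refine ⟨p, 0, 0, 1, x', y', z, w, by ring, ?_, by ring, by ring, by ring, by ring⟩
      apply mul_left_cancel₀ hp0
      linear_combination h
    · refine ⟨1, 0, k, p, x, y, z', w', by ring, ?_, by ring, by ring, ?_, ?_⟩
      · apply mul_left_cancel₀ hp0
        linear_combination h + y * hz - x * hw
      · linear_combination hz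
      · linear_combination hw
  -- The determinant vanishes modulo `p`, so the rows are proportional there; `k` comes from
  -- inverting an entry of the first row that is prime to `p`.
  by_cases hx : (p : ℤ) ∣ x
  · by_cases hy : (p : ℤ) ∣ y
    · exact Or.inl ⟨hx, hy⟩
    · obtain ⟨u, v, e⟩ := cop y hy
      refine Or.inr ⟨w * u, ⟨z * v - m * u, ?_⟩, ⟨w * v, ?_⟩⟩
      · linear_combination (-z) * e - u * h
      · linear_combination (-w) * e
  · obtain ⟨u, v, e⟩ := cop x hx
    refine Or.inr ⟨z * u, ⟨z * v, ?_⟩, ⟨w * v + m * u, ?_⟩⟩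
    · linear_combination (-z) * e
    · linear_combination (-w) * e + u * h

/-- The prime is split off on the side of `g`, so the remaining substitution starts from
discriminant `D p²`. -/
theorem IsDerived.exists_factor [NegDisc D] {D'' m : ℤ} {p : ℕ} (hp : p.Prime) {f : Form D''}
    {g : Form D} (h : IsDerived (p * m) f g) :
    ∃ k : Form (D * (p : ℤ) ^ 2), IsDerived m f k ∧ IsDerived p k g := by
  obtain ⟨A, hd, hA⟩ := h
  rw [Matrix.det_fin_two] at hd
  obtain ⟨x₁, y₁, z₁, w₁, x₂, y₂, z₂, w₂, h₁, h₂, hx, hy, hz, hw⟩ := exists_matrix_factor hp hd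
  refine exists_intermediate f g (by exact_mod_cast hp.ne_zero) h₁ h₂ fun s t => ?_
  rw [hA, hx, hy, hz, hw]
  congr 1 <;> ring

/-- Every form of discriminant `D p²` is equivalent to a form `(a, p b, p² c)` with `a` prime
to `p`, where `(a, b, c)` is a form of discriminant `D`. -/
theorem exists_reduction_at_prime {D' : ℤ} [NegDisc D'] {p : ℕ} (hp : p.Prime) (hodd : p ≠ 2)
    (hD' : D' = D * p ^ 2) (f : Form D') :
    ∃ (f' : Form D') (g' : Form D), f'.Equiv f ∧ IsCoprime f'.a p ∧
      f'.a = g'.a ∧ f'.b = p * g'.b ∧ f'.c = p ^ 2 * g'.c := by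
  have hp0 : (p : ℤ) ≠ 0 := by exact_mod_cast hp.ne_zero
  obtain ⟨s, t, ⟨w, q, hst⟩, hc⟩ := f.exists_coprime_value hp.ne_zero
  obtain ⟨f₁, e₁, a₁, -⟩ := f.exists_subst (p := s) (q := -q) (r := t) (s := w)
    (by linear_combination hst)
  rw [← a₁] at hc
  have c2 : IsCoprime (2 : ℤ) p := by
    rw [← Nat.cast_two, Nat.isCoprime_iff_coprime]
    exact (Nat.coprime_primes Nat.prime_two hp).2 (Ne.symm hodd)
  -- Since `u * (2 a) + v * p = 1`, the translation by `-u b` changes the middle coefficient `b`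
  -- into `b - 2 a u b = p v b`.
  obtain ⟨u, v, huv⟩ := c2.mul_left hc
  obtain ⟨f₂, e₂, a₂, b₂⟩ := f₁.exists_subst (p := 1) (q := -u * f₁.b) (r := 0) (s := 1) (by ring)
  have a₂' : f₂.a = f₁.a := by rw [a₂, eval]; ring
  have hb : f₂.b = p * (v * f₁.b) := by
    rw [b₂]
    linear_combination (-f₁.b) * huv
  have hd := f₂.disc
  -- Both the discriminant and the square of the middle coefficient are divisible by `p²`.
  have hdvd : (p : ℤ) ^ 2 ∣ (4 * f₂.a) * f₂.c :=
    ⟨(v * f₁.b) ^ 2 - D, by rw [hb] at hd; linear_combination -hd - hD'⟩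
  have c4 : IsCoprime ((p : ℤ) ^ 2) (4 * f₂.a) := by
    rw [a₂']
    have := c2.mul_left (c2.mul_left hc)
    rw [← mul_assoc] at this
    exact this.symm.pow_left
  obtain ⟨c, hc'⟩ := c4.dvd_of_dvd_mul_left hdvd
  refine ⟨f₂, ⟨f₂.a, v * f₁.b, c, ?_, ?_, f₂.pos⟩, equiv_trans e₂ e₁, by rwa [a₂'], rfl, hb, hc'⟩
  · apply mul_left_cancel₀ (pow_ne_zero 2 hp0)
    rw [hb, hc'] at hd
    linear_combination hd + hD'
  · rw [← Int.isCoprime_iff_gcd_eq_one]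
    apply isCoprime_of_primes
    intro l hl h1 h2
    refine f₂.not_dvd_all hl (h1.trans (Int.gcd_dvd_left ..)) ?_ ?_
    · rw [hb]; exact (h1.trans (Int.gcd_dvd_right ..)).mul_left _
    · rw [hc']; exact h2.mul_left _

/-- If `(a, p b, p² c)`, with `a` prime to `p`, is derived from `g` by a substitution of
determinant `p`, then `(a, b, c)` is equivalent to `g`. -/
theorem IsDerived.equiv_of_reduction {D' : ℤ} {p : ℕ} (hp : p.Prime) (hodd : p ≠ 2)
    {f : Form D'} {g g' : Form D} (hf : IsDerived p f g) (hc : IsCoprime f.a p)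
    (ha : f.a = g'.a) (hb : f.b = p * g'.b) (hc' : f.c = p ^ 2 * g'.c) : g'.Equiv g := by
  have hp0 : (p : ℤ) ≠ 0 := by exact_mod_cast hp.ne_zero
  obtain ⟨x, y, z, w, hdet, fa, fb, fc⟩ := (isDerived_iff f g).1 hf
  have c2 : IsCoprime (2 : ℤ) p := by
    rw [← Nat.cast_two, Nat.isCoprime_iff_coprime]
    exact (Nat.coprime_primes Nat.prime_two hp).2 (Ne.symm hodd)
  have cop := (c2.mul_left hc).symm
  have fa' := fa
  rw [eval] at fa'
  -- From `2 f.a y - f.b x = -(det) (g.b x + 2 g.c z)` and its analogue for `w`, the prime `p`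
  -- divides the second column. Dividing that column by `p` leaves a matrix of determinant `1`
  -- carrying `g` to `g'`.
  have dy : (p : ℤ) ∣ (2 * f.a) * y := ⟨g'.b * x - (g.b * x + 2 * g.c * z), by
    linear_combination 2 * y * fa' - x * fb + x * hb - (g.b * x + 2 * g.c * z) * hdet⟩
  have dw : (p : ℤ) ∣ (2 * f.a) * w := ⟨g'.b * z + (2 * g.a * x + g.b * z), by
    linear_combination 2 * w * fa' - z * fb + z * hb + (2 * g.a * x + g.b * z) * hdet⟩
  obtain ⟨y, rfl⟩ := cop.dvd_of_dvd_mul_left dy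
  obtain ⟨w, rfl⟩ := cop.dvd_of_dvd_mul_left dw
  refine (equiv_iff g' g).2 ⟨x, y, z, w, ?_, ?_, ?_, ?_⟩
  · apply mul_left_cancel₀ hp0
    linear_combination hdet
  · rw [← ha, fa]
  · apply mul_left_cancel₀ hp0
    linear_combination fb - hb
  · apply mul_left_cancel₀ (pow_ne_zero 2 hp0)
    rw [← hc', fc, eval, eval]
    ring

end Form

/-! ### Recursion for `phi` -/

/-- At primes `q ≠ p` the symbols of `D` and `D p²` agree. At `p` the symbol of `D p²` is `0`: if `p
^ e` exactly divides `r` with `e > 0`, the factor of `phi (D p²) r` is `p ^ e`, just the power of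
`p` needed in `phi D (p * r)`. -/
theorem phi_prime_mul (D : ℤ) {p r : ℕ} (hp : p.Prime) (hr : r ≠ 0) :
    phi D (p * r) = ((p : ℤ) - jacobiSym D p) * phi (D * (p : ℤ) ^ 2) r := by
  classical
  have hfp : (p * r).factorization p = r.factorization p + 1 := by
    rw [Nat.factorization_mul hp.ne_zero hr]
    simp [hp.factorization_self, add_comm]
  have hf : ∀ q ∈ r.primeFactors, q ≠ p →
      (q : ℤ) ^ (r.factorization q - 1) * ((q : ℤ) - jacobiSym (D * (p : ℤ) ^ 2) q) =
        (q : ℤ) ^ ((p * r).factorization q - 1) * ((q : ℤ) - jacobiSym D q) := by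
    intro q hq hqp
    have hq' := Nat.prime_of_mem_primeFactors hq
    have h1 : (p * r).factorization q = r.factorization q := by
      rw [Nat.factorization_mul hp.ne_zero hr]
      simp [hp.factorization, Ne.symm hqp]
    have h2 : ((p : ℤ)).gcd q = 1 := by
      rw [Int.gcd_natCast_natCast]
      exact (Nat.coprime_primes hp hq').2 (Ne.symm hqp)
    rw [h1, jacobiSym.mul_left, jacobiSym.sq_one' h2, mul_one]
  have hself : (p * r).primeFactors = insert p r.primeFactors := by
    rw [Nat.primeFactors_mul hp.ne_zero hr, hp.primeFactors, Finset.insert_eq]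
  rw [phi, phi, hself]
  by_cases hpr : p ∈ r.primeFactors
  · rw [Finset.insert_eq_of_mem hpr, ← Finset.mul_prod_erase _ _ hpr,
      ← Finset.mul_prod_erase r.primeFactors _ hpr, ← Finset.prod_congr rfl fun q hq =>
        hf q (Finset.mem_of_mem_erase hq) (Finset.ne_of_mem_erase hq)]
    have h0 : jacobiSym (D * (p : ℤ) ^ 2) p = 0 := by
      have : NeZero p := ⟨hp.ne_zero⟩
      refine jacobiSym.eq_zero_iff_not_coprime.2 fun h => ?_
      have h' : (p : ℤ) ∣ Int.gcd (D * (p : ℤ) ^ 2) p :=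
        Int.dvd_coe_gcd ⟨D * p, by ring⟩ dvd_rfl
      rw [h] at h'
      exact hp.one_lt.ne' (Nat.dvd_one.1 (by exact_mod_cast h'))
    have h1 : 0 < r.factorization p :=
      hp.factorization_pos_of_dvd hr (Nat.dvd_of_mem_primeFactors hpr)
    obtain ⟨e, he⟩ : ∃ e, r.factorization p = e + 1 := ⟨_, (Nat.succ_pred h1.ne').symm⟩
    rw [h0, hfp, he]
    simp only [Nat.add_sub_cancel]
    ring
  · rw [Finset.prod_insert hpr, ← Finset.prod_congr rfl fun q hq =>
      hf q hq (ne_of_mem_of_not_mem hq hpr), hfp]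
    have h1 : r.factorization p = 0 := by
      rw [← Finsupp.notMem_support_iff]
      exact hpr
    rw [h1]
    simp

/-! ### Lattices of forms of discriminant `D p²` and the order of discriminant `D` -/

namespace Form

variable {D D' : ℤ} {p : ℕ}

theorem rt_mul_sq (hD' : D' = D * (p : ℤ) ^ 2) : rt D' = p * rt D := by
  have h : (-(D' : ℝ)) = (p : ℝ) ^ 2 * (-D) := by rw [hD']; push_cast; ring
  rw [rt, rt, h, Real.sqrt_mul (sq_nonneg _), Real.sqrt_sq (Nat.cast_nonneg p)]
  push_cast; ring

theorem Homothetic.pow {L M : Submodule ℤ ℂ} (h : Homothetic L M) (n : ℕ) :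
    Homothetic (L ^ n) (M ^ n) := by
  induction n with
  | zero => exact .of_eq (by simp)
  | succ n ih => rw [pow_succ, pow_succ]; exact ih.mul h

/-- The exponent is positive because the zeroth power of a lattice is `ℤ`, not the order that
represents the identity class. -/
theorem homothetic_lat_pow [NegDisc D] (f : Form D) (n : ℕ) :
    ∀ k : Form D, FormClass.mk f ^ (n + 1) = FormClass.mk k →
      Homothetic (f.lat ^ (n + 1)) k.lat := by
  induction n with
  | zero =>
    intro k hk
    rw [zero_add, pow_one] at hk ⊢
    exact (FormClass.mk_eq.1 hk).homothetic
  | succ n ih =>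
    intro k hk
    obtain ⟨l, hl⟩ := FormClass.exists_rep (FormClass.mk f ^ (n + 1))
    rw [pow_succ, ← hl] at hk
    rw [pow_succ]
    exact ((ih l hl.symm).mul (.of_eq rfl)).trans (FormClass.lat_of_mul hk)

/-- The lattice of `(a, p b, p² c)`, with `a` prime to `p`, generates that of `(a, b, c)` over
the order of discriminant `D`, up to homothety. -/
theorem homothetic_lat_mul_principal [NegDisc D] (hD' : D' = D * (p : ℤ) ^ 2)
    {f : Form D'} {g : Form D} (hc : IsCoprime f.a p) (ha : f.a = g.a) (hb : f.b = p * g.b) :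
    Homothetic (f.lat * (principal D).lat) g.lat := by
  have hδ := rt_sq (D := D)
  have hg := cast_disc g
  obtain ⟨k, hk⟩ : ∃ k, g.b = D % 2 + 2 * k := by
    have := g.b_emod
    exact ⟨g.b / 2, by omega⟩
  have hpb : (principal D).b = D % 2 := rfl
  have hk' : (g.b : ℂ) = (principal D).b + 2 * k := by
    rw [hpb]; exact_mod_cast congrArg (Int.cast : ℤ → ℂ) hk
  have hpa : ((principal D).a : ℂ) = 1 := by simp [principal]
  obtain ⟨u, v, huv⟩ := hc
  have huv' : (u : ℂ) * g.a + v * p = 1 := by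
    rw [ha] at huv
    exact_mod_cast congrArg (Int.cast : ℤ → ℂ) huv
  have hb' : (f.b : ℂ) = p * g.b := by exact_mod_cast congrArg (Int.cast : ℤ → ℂ) hb
  -- Each `lat` is twice the usual ideal, so the product carries one extra factor `2`.
  refine ⟨1, 2, one_ne_zero, two_ne_zero, ?_⟩
  rw [← Submodule.one_eq_span, one_mul, lat, lat, lat, mul_span_pair, rt_mul_sq hD', hb', ha, hpa]
  apply le_antisymm
  · rw [Submodule.span_mul_span, Submodule.span_le]
    rintro z ⟨z₁, (rfl | rfl), z₂, (rfl | rfl), rfl⟩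
    · exact mem_pair 1 0 (by push_cast; ring)
    · exact mem_pair k g.a (by push_cast; linear_combination (-2 * g.a : ℂ) * hk')
    · exact mem_pair 0 p (by push_cast; ring)
    · refine mem_pair (-(p * g.c)) (p * k - p * g.b) ?_
      push_cast
      linear_combination (-p * (-g.b + rt D) : ℂ) * hk' - (p : ℂ) * hδ + (p : ℂ) * hg
  · have sm : ∀ x ∈ ({(2 * g.a : ℂ), -(p * g.b) + p * rt D} : Set ℂ),
        ∀ y ∈ ({(2 * 1 : ℂ), -(principal D).b + rt D} : Set ℂ),
        x * y ∈ Submodule.span ℤ {(2 * g.a : ℂ), -(p * g.b) + p * rt D} *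
          Submodule.span ℤ {(2 * 1 : ℂ), -(principal D).b + rt D} :=
      fun x hx y hy => Submodule.mul_mem_mul (Submodule.subset_span hx) (Submodule.subset_span hy)
    have s1 := sm (2 * g.a) (by simp) (2 * 1) (by simp)
    have s2 := sm (2 * g.a) (by simp) (-(principal D).b + rt D) (by simp)
    have s3 := sm (-(p * g.b) + p * rt D) (by simp) (2 * 1) (by simp)
    refine span_pair_le ?_ ?_
    · convert s1 using 1
      ring
    -- With `u a + v p = 1`, the generator `2 (-b + √D)` combines `2 a (-b + √D)` and `2 p (-b +
    -- √D)`; the term in `s1` accounts for the principal form having another middle coefficient.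
    · convert add_mem (add_mem (Submodule.smul_mem _ u s2) (Submodule.smul_mem _ v s3))
        (Submodule.smul_mem _ (-(u * k)) s1) using 1
      simp only [zsmul_eq_mul]
      push_cast
      linear_combination (-2 * (-g.b + rt D) : ℂ) * huv' - (2 * u * g.a : ℂ) * hk'

/-- The quadratic order of discriminant `D`. -/
abbrev Order (D : ℤ) [NegDisc D] : Type :=
  QuadraticAlgebra ℤ (-(principal D).c) (-(principal D).b)

/-- The generator `(-b + √D) / 2` of the quadratic order, as a complex number. -/
noncomputable def orderRoot (D : ℤ) [NegDisc D] : ℂ := (-(principal D).b + rt D) / 2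

theorem orderRoot_mul_self (D : ℤ) [NegDisc D] : orderRoot D * orderRoot D =
    (-(principal D).c) • (1 : ℂ) + (-(principal D).b) • orderRoot D := by
  have h := cast_disc (principal D)
  have hpa : ((principal D).a : ℂ) = 1 := by simp [principal]
  have hδ := rt_sq (D := D)
  rw [hpa] at h
  simp only [zsmul_eq_mul, orderRoot]
  push_cast
  linear_combination hδ / 4 - h / 4

/-- The embedding of the quadratic order in the complex numbers. -/
noncomputable def orderEmb (D : ℤ) [NegDisc D] : Order D →ₐ[ℤ] ℂ :=
  QuadraticAlgebra.lift ⟨orderRoot D, orderRoot_mul_self D⟩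

theorem orderEmb_apply [NegDisc D] (z : Order D) :
    orderEmb D z = z.re + z.im * orderRoot D := by
  simp [orderEmb, QuadraticAlgebra.lift]

theorem mem_map_lineLattice [NegDisc D] {v : Order D} {x : ℂ} :
    x ∈ (lineLattice p v).map (orderEmb D).toLinearMap ↔
      ∃ k s t : ℤ, k * orderEmb D v + p * (s + t * orderRoot D) = x := by
  simp only [Submodule.mem_map, mem_lineLattice]
  constructor
  · rintro ⟨_, ⟨k, z, rfl⟩, rfl⟩
    refine ⟨k, z.re, z.im, ?_⟩
    rw [← orderEmb_apply]
    simp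
  · rintro ⟨k, s, t, rfl⟩
    refine ⟨_, ⟨k, ⟨s, t⟩, rfl⟩, ?_⟩
    rw [AlgHom.toLinearMap_apply, map_add, map_mul, map_mul, map_intCast, map_natCast,
      orderEmb_apply ⟨s, t⟩]

/-- If `(a, b, c)` is equivalent to the principal form, then the lattice of `(a, p b, p² c)` is
`ℤ v + p O` up to homothety, where `v` is an element of norm `a` of the order `O` of
discriminant `D`. -/
theorem homothetic_map_lineLattice [NegDisc D] (hD' : D' = D * (p : ℤ) ^ 2)
    {f : Form D'} {g : Form D} (ha : f.a = g.a) (hb : f.b = p * g.b)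
    (hg : g.Equiv (principal D)) :
    ∃ x z : ℤ, g.a = (principal D).eval x z ∧
      Homothetic f.lat ((lineLattice p (⟨x, -z⟩ : Order D)).map (orderEmb D).toLinearMap) := by
  obtain ⟨x, y, z, w, hd, ga, gb, -⟩ := (equiv_iff _ _).1 hg
  refine ⟨x, z, ga, ?_⟩
  have hδ := rt_sq (D := D)
  have hP := cast_disc (principal D)
  have hpa : (principal D).a = 1 := rfl
  rw [eval, hpa] at ga
  rw [hpa] at gb hP
  have ga' : (g.a : ℂ) = x ^ 2 + (principal D).b * x * z + (principal D).c * z ^ 2 := by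
    rw [ga]; push_cast; ring
  have gb' : (g.b : ℂ) = 2 * x * y + (principal D).b * (x * w + y * z)
      + 2 * (principal D).c * z * w := by
    rw [gb]; push_cast; ring
  have hd' : (x : ℂ) * w - y * z = 1 := by exact_mod_cast congrArg (Int.cast : ℤ → ℂ) hd
  have hga : (g.a : ℂ) ≠ 0 := by exact_mod_cast g.pos.ne'
  have hb' : (f.b : ℂ) = p * g.b := by exact_mod_cast congrArg (Int.cast : ℤ → ℂ) hb
  have hv : orderEmb D (⟨x, -z⟩ : Order D) = x - z * orderRoot D := by
    rw [orderEmb_apply]; push_cast; ring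
  have hω : rt D = 2 * orderRoot D + (principal D).b := by rw [orderRoot]; ring
  have hωω := orderRoot_mul_self D
  simp only [zsmul_eq_mul] at hωω
  push_cast at hωω
  -- With `ω = orderRoot D`, multiplication by `v = x - z ω` carries the lattice of `f` to `2 a (ℤ v
  -- + ℤ p (w ω - y))`. As `x w - y z = 1`, the pair `v`, `w ω - y` is a basis of `O`, so the
  -- bracket is `ℤ v + p O`.
  have e2 : ((x : ℂ) - z * orderRoot D) * (-g.b + rt D) =
      2 * g.a * (w * orderRoot D - y) := by
    rw [ga', gb', hω]
    linear_combination (-2 * z : ℂ) * hωω -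
      (x * (principal D).b + 2 * x * orderRoot D + z * (principal D).b * orderRoot D +
        2 * z * (principal D).c) * hd'
  have hne : (x : ℂ) - z * orderRoot D ≠ 0 := by
    intro h0
    have h1 : ((x : ℂ) - z * orderRoot D) * (x + z * (principal D).b + z * orderRoot D) = g.a := by
      rw [ga']
      linear_combination (-(z : ℂ) ^ 2) * hωω
    rw [h0, zero_mul] at h1
    exact hga h1.symm
  refine ⟨x - z * orderRoot D, 2 * g.a, hne, by simpa using hga, ?_⟩
  rw [lat, mul_span_pair, rt_mul_sq hD', hb', ha]
  apply le_antisymm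
  · refine span_pair_le ?_ ?_
    · have : (x : ℂ) - z * orderRoot D ∈
          (lineLattice p (⟨x, -z⟩ : Order D)).map (orderEmb D).toLinearMap :=
        mem_map_lineLattice.2 ⟨1, 0, 0, by rw [hv]; push_cast; ring⟩
      convert Submodule.mul_mem_mul (Submodule.mem_span_singleton_self (2 * g.a : ℂ)) this using 1
      ring
    · have : (p : ℂ) * (w * orderRoot D - y) ∈
          (lineLattice p (⟨x, -z⟩ : Order D)).map (orderEmb D).toLinearMap :=
        mem_map_lineLattice.2 ⟨0, -y, w, by push_cast; ring⟩
      convert Submodule.mul_mem_mul (Submodule.mem_span_singleton_self (2 * g.a : ℂ)) this using 1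
      linear_combination (p : ℂ) * e2
  · rw [Submodule.mul_le]
    intro s hs t ht
    obtain ⟨m, rfl⟩ := Submodule.mem_span_singleton.1 hs
    obtain ⟨k, i, j, rfl⟩ := mem_map_lineLattice.1 ht
    rw [hv]
    -- In that basis, `i + j ω = (i w + j y) v + (i z + j x) (w ω - y)`.
    refine mem_pair (m * (k + p * (i * w + j * y))) (m * (i * z + j * x)) ?_
    simp only [zsmul_eq_mul]
    push_cast
    linear_combination (m * (i * z + j * x) * p : ℂ) * e2 +
      (2 * m * g.a * p * (i + j * orderRoot D) : ℂ) * hd'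

/-- The order of discriminant `D p²` is `ℤ + p O`. As `p` is odd, `p` times the middle coefficient
of one principal form has the parity of the other's, so it may replace it in the lattice. -/
theorem homothetic_map_lineLattice_one [NegDisc D] [NegDisc D'] (hp : p.Prime) (hodd : p ≠ 2)
    (hD' : D' = D * (p : ℤ) ^ 2) :
    Homothetic ((lineLattice p (1 : Order D)).map (orderEmb D).toLinearMap)
      (principal D').lat := by
  have hpa : ((principal D').a : ℂ) = 1 := by simp [principal]
  have hB : p * (principal D).b ≡ (principal D').b [ZMOD 2 * (principal D').a] := by
    have h1 : (p : ℤ) % 2 = 1 := by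
      have := hp.eq_two_or_odd
      omega
    change p * (D % 2) ≡ D' % 2 [ZMOD 2 * 1]
    rw [hD', Int.ModEq]
    simp [Int.mul_emod, pow_two, h1]
  have hω : rt D = 2 * orderRoot D + (principal D).b := by rw [orderRoot]; ring
  refine ⟨2, 1, two_ne_zero, one_ne_zero, ?_⟩
  rw [lat_eq_of_modEq _ hB, mul_span_pair, rt_mul_sq hD', hpa, hω]
  push_cast
  apply le_antisymm
  · rw [Submodule.mul_le]
    intro s hs t ht
    obtain ⟨m, rfl⟩ := Submodule.mem_span_singleton.1 hs
    obtain ⟨k, i, j, rfl⟩ := mem_map_lineLattice.1 ht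
    rw [map_one]
    refine mem_pair (m * (k + p * i)) (m * j) ?_
    simp only [zsmul_eq_mul]
    push_cast
    ring
  · have h1 : (1 : ℂ) ∈ (lineLattice p (1 : Order D)).map (orderEmb D).toLinearMap :=
      mem_map_lineLattice.2 ⟨1, 0, 0, by simp⟩
    have h2 : (p : ℂ) * orderRoot D ∈
        (lineLattice p (1 : Order D)).map (orderEmb D).toLinearMap :=
      mem_map_lineLattice.2 ⟨0, 0, 1, by simp⟩
    refine span_pair_le ?_ ?_
    · convert Submodule.mul_mem_mul (Submodule.mem_span_singleton_self (2 : ℂ)) h1 using 1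
      ring
    · convert Submodule.mul_mem_mul (Submodule.mem_span_singleton_self (2 : ℂ)) h2 using 1
      ring

theorem lineLattice_pow_eq_one_of_eval [NegDisc D] [Fact p.Prime] (hodd : p ≠ 2) {x z : ℤ}
    (hc : IsCoprime ((principal D).eval x z) p) {n : ℕ} (hn : (n : ℤ) = p - jacobiSym D p) :
    lineLattice p (⟨x, -z⟩ : Order D) ^ n = lineLattice p 1 := by
  have hP := (principal D).disc
  have hpa : (principal D).a = 1 := rfl
  obtain ⟨X, hX⟩ : ∃ X, X = 2 * x + z * (principal D).b := ⟨_, rfl⟩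
  obtain ⟨a, ha⟩ : ∃ a, a = (principal D).eval x z := ⟨_, rfl⟩
  rw [← ha] at hc
  rw [eval, hpa] at ha
  -- Here `δ = b + 2 ω` is the root `√D` in the order, and `X` is the trace of `v = x - z ω`, whose
  -- conjugate is `X - v`.
  refine lineLattice_pow_eq_one (D := D) (X := X) (Y := -z) (a := a) (δ := ⟨(principal D).b, 2⟩) hodd ?_ ?_ ?_ ?_ hc hn
  · rw [hpa] at hP
    ext
    · simp [pow_two]; linarith
    · simp [pow_two]; ring
  · rw [two_mul]
    ext
    · simp; linarith
    · simp; ring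
  · rw [hpa] at hP
    rw [hX, ha]
    linear_combination z ^ 2 * hP
  · ext
    · simp; rw [hX, ha]; ring
    · simp; rw [hX]; ring

end Form

/-! ### Orders of classes: the prime case and the induction -/

namespace FormClass

open Form

variable {D : ℤ}

/-- The prime case: a class of discriminant `D p²` whose lattice generates a principal one over
the order of discriminant `D`. -/
theorem pow_eq_one_of_homothetic {D' : ℤ} [NegDisc D] [NegDisc D'] {p : ℕ} (hp : p.Prime)
    (hodd : p ≠ 2) (hD' : D' = D * (p : ℤ) ^ 2) {f : Form D'}
    (hf : Homothetic (f.lat * (principal D).lat) (principal D).lat) {n : ℕ}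
    (hn : (n : ℤ) = p - jacobiSym D p) : mk f ^ n = 1 := by
  have : Fact p.Prime := ⟨hp⟩
  obtain ⟨f', g', e, hc, ha, hb, -⟩ := exists_reduction_at_prime hp hodd hD' f
  have hg : g'.Equiv (principal D) := equiv_of_homothetic
    (((homothetic_lat_mul_principal hD' hc ha hb).symm.trans
      (e.homothetic.mul (.of_eq rfl))).trans hf)
  obtain ⟨x, z, hxz, H⟩ := homothetic_map_lineLattice hD' ha hb hg
  have hpow := H.pow n
  rw [← Submodule.map_pow, lineLattice_pow_eq_one_of_eval hodd (by rwa [← hxz, ← ha]) hn] at hpow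
  -- The exponent is at least `p - 1 > 0`.
  obtain ⟨l, rfl⟩ : ∃ l, n = l + 1 := by
    refine Nat.exists_eq_succ_of_ne_zero ?_
    rintro rfl
    have := hp.one_lt
    rcases jacobiSym.trichotomy D p with hs | hs | hs <;> rw [hs] at hn <;> omega
  rw [← mk_eq.2 e]
  obtain ⟨k, hk⟩ := exists_rep (mk f' ^ (l + 1))
  rw [← hk]
  exact mk_eq.2 (equiv_of_homothetic ((homothetic_lat_pow f' l k hk.symm).symm.trans
    (hpow.trans (homothetic_map_lineLattice_one hp hodd hD'))))

/-- Extension to the order of discriminant `D` takes `f` to `g` and respects products, so `f` raised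
to the order of `g` extends to the principal class; `pow_eq_one_of_homothetic` then kills it. -/
theorem orderOf_dvd_of_isDerived_prime {D' : ℤ} [NegDisc D] [NegDisc D'] {p : ℕ}
    (hp : p.Prime) (hodd : p ≠ 2) (hD' : D' = D * (p : ℤ) ^ 2) {f : Form D'} {g : Form D}
    (h : Form.IsDerived p f g) :
    (orderOf (mk f) : ℤ) ∣ orderOf (mk g) * (p - jacobiSym D p) := by
  obtain ⟨n, hn⟩ : ∃ n : ℕ, (n : ℤ) = p - jacobiSym D p := by
    refine Int.eq_ofNat_of_zero_le ?_ |>.imp fun _ h => h.symm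
    have := hp.one_lt
    rcases jacobiSym.trichotomy D p with hs | hs | hs <;> rw [hs] <;> omega
  rw [← hn]
  norm_cast
  rw [orderOf_dvd_iff_pow_eq_one, pow_mul]
  obtain ⟨a, ha⟩ : ∃ a, orderOf (mk g) = a + 1 :=
    Nat.exists_eq_succ_of_ne_zero (orderOf_pos _).ne'
  have hga : mk g ^ (a + 1) = mk (principal D) := by rw [← ha, pow_orderOf_eq_one]; rfl
  -- Raising `f.lat * (principal D).lat` to a power also raises the second factor, which is
  -- idempotent up to homothety.
  have h1a : mk (principal D) ^ (a + 1) = mk (principal D) := one_pow (M := FormClass D) _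
  rw [ha]
  obtain ⟨k, hk⟩ := exists_rep (mk f ^ (a + 1))
  rw [← hk]
  refine pow_eq_one_of_homothetic hp hodd hD' ?_ hn
  obtain ⟨f', g', e, hc, ea, eb, ec⟩ := exists_reduction_at_prime hp hodd hD' f
  have hfg : Homothetic (f.lat * (principal D).lat) g.lat :=
    ((equiv_symm e).homothetic.mul (.of_eq rfl)).trans
      ((homothetic_lat_mul_principal hD' hc ea eb).trans
        ((h.equiv e).equiv_of_reduction hp hodd hc ea eb ec).homothetic)
  have h2 := hfg.pow (a + 1)
  rw [mul_pow] at h2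
  exact (((homothetic_lat_pow f a k hk.symm).symm.mul
    (homothetic_lat_pow _ a _ h1a).symm).trans h2).trans (homothetic_lat_pow g a _ hga)

/-- The discriminants vary in the induction, since the step passes from `D` to `D p²`; tying `D'` to
`D` by an equation avoids transporting forms between equal discriminants. -/
theorem orderOf_dvd_of_isDerived (r : ℕ) : Odd r → ∀ (D D' : ℤ) [NegDisc D] [NegDisc D'],
    D' = D * (r : ℤ) ^ 2 → ∀ (f : Form D') (g : Form D), Form.IsDerived r f g →
      (orderOf (mk f) : ℤ) ∣ orderOf (mk g) * phi D r := by
  induction r using induction_on_primes with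
  | zero => exact fun h => absurd h (by decide)
  | one =>
    intro _ D D' _ _ hD' f g h
    obtain rfl : D' = D := by simpa using hD'
    rw [mk_eq.2 (equiv_of_isDerived_one (by simpa using h))]
    simp [phi]
  | prime_mul p r hp ih =>
    intro hr D D' _ _ hD' f g h
    obtain ⟨hpo, hro⟩ := Nat.odd_mul.1 hr
    have hodd : p ≠ 2 := by rintro rfl; exact absurd hpo (by decide)
    have : NeZero p := ⟨hp.ne_zero⟩
    rw [Nat.cast_mul] at h
    obtain ⟨k, hk₁, hk₂⟩ := h.exists_factor hp
    have h1 := ih hro (D * (p : ℤ) ^ 2) D' (by rw [hD']; push_cast; ring) f k hk₁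
    have h2 := orderOf_dvd_of_isDerived_prime hp hodd rfl hk₂
    rw [phi_prime_mul D hp hro.pos.ne', ← mul_assoc]
    exact h1.trans (mul_dvd_mul_right h2 _)

end FormClass

end BQF

theorem mainTheorem6 (D : ℤ) [BQF.NegDisc D] (r : ℕ) [NeZero r] (hr : Odd r)
    (f : BQF.FormClass (D * (r : ℤ) ^ 2)) (g : BQF.FormClass D)
    (hfg : BQF.FormClass.IsDerived (r : ℤ) f g) :
    (orderOf f : ℤ) ∣ (orderOf g : ℤ) * BQF.phi D r := by
  obtain ⟨f, g, rfl, rfl, h⟩ := hfg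
  exact BQF.FormClass.orderOf_dvd_of_isDerived r hr D _ rfl f g h
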